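/- Let $m,n,T\ge 1$ be integers, let $1\le p<\infty$, $\gamma>0$, $c>0$, $\varepsilon>0$, and let $x_i^t$ ($1\le i\le m$, $1\le t\le T$) and $y_j^t$ ($1\le j\le n$, $1\le t\le T$) be states, each of which is either a point of a real normed space (for instance $\mathbb R^N$) or empty. Put $x_{m+1}^t=y_{n+1}^t=\varnothing$ for all $t$. For $1\le i,k\le m+1$ and $1\le j,l\le n+1$ let $$(D^t_{(i,j)})^{1/p}=\begin{cases}\min(\|x_i^t-y_j^t\|,c), & x_i^t\ne\varnothing,\ y_j^t\neq\varnothing,\\ 0,& x_i^t=y_j^t=\varnothing,\\ c/2^{1/p},&\text{otherwise,}\end{cases}$$ $$F_{(i,j),(k,l)}=\begin{cases}\frac{\gamma^p}{2}(1-\delta_{ik}\delta_{jl})\big((1-\delta_{k,m+1})(1-\delta_{l,n+1})+(1-\delta_{i,m+1})(1-\delta_{j,n+1})\big), & i=k,\\ \infty,& i\ne k,\end{cases}$$ and $$C_{(i_1,j_1),\dots,(i_T,j_T)}=\sum_{t=1}^T D^t_{(i_t,j_t)}+\sum_{t=1}^{T-1}F_{(i_t,j_t),(i_{t+1},j_{t+1})}.$$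 Let $\bar\mu=(1,\dots,1,n)\in\mathbb R^{m+1}$ and $\tilde\mu=(1,\dots,1,m)\in\mathbb R^{n+1}$. Consider the regularized dual problem of maximizing, over all $\bar\lambda^t\in\mathbb R^{m+1}$, $\tilde\lambda^t\in\mathbb R^{n+1}$ ($t=1,\dots,T$), $$\phi(\bar\lambda,\tilde\lambda)=-\varepsilon\sum_{(i_1,j_1),\dots,(i_T,j_T)}e^{-C_{(i_1,j_1),\dots,(i_T,j_T)}/\varepsilon}\prod_{t=1}^T e^{\bar\lambda^t_{i_t}/\varepsilon}\prod_{t=1}^T e^{\tilde\lambda^t_{j_t}/\varepsilon}+\sum_{t=1}^T\sum_{i=1}^{m+1}\bar\mu_i\bar\lambda^t_i+\sum_{t=1}^T\sum_{j=1}^{n+1}\tilde\mu_j\tilde\lambda^t_j+\varepsilon(m+1)^T(n+1)^T,$$ where $e^{-\infty}=0$. Let $k^t_{(i,j)}=e^{-D^t_{(i,j)}/\varepsilon}$ and $\hat k_{(i,j),(k,l)}=e^{-F_{(i,j),(k,l)}/\varepsilon}$. Algorithm. Start with $\bar u^t=\mathbf 1$ and $\tilde u^t=\mathbf 1$ for all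 $t$. Each iteration does the following. First, $\overleftarrow\Phi^T=1$ and, for $t=T-1,\dots,1$, $$\overleftarrow\Phi^t_{(i,j)}=\sum_{(k,l)}\overleftarrow\Phi^{t+1}_{(k,l)}\,k^{t+1}_{(k,l)}\,\hat k_{(i,j),(k,l)}\,\bar u^{t+1}_k\,\tilde u^{t+1}_l .$$ Then $\overrightarrow\Phi^1=1$ and, for $t=1,\dots,T$ in this order: 1. with $P_{(i,j)}=\overrightarrow\Phi^t_{(i,j)}k^t_{(i,j)}\bar u^t_i\tilde u^t_j\overleftarrow\Phi^t_{(i,j)}$, replace $\bar u^t_i$ by $\bar\mu_i\,\bar u^t_i/\sum_{j}P_{(i,j)}$ for all $i$; 2. with $P$ recomputed by the same formula from the new $\bar u^t$, replace $\tilde u^t_j$ by $\tilde\mu_j\,\tilde u^t_j/\sum_{i}P_{(i,j)}$ for all $j$; 3. if $t<T$, put $\overrightarrow\Phi^{t+1}_{(k,l)}=\sum_{(i,j)}\overrightarrow\Phi^t_{(i,j)}\,k^t_{(i,j)}\,\hat k_{(i,j),(k,l)}\,\bar u^t_i\,\tilde u^t_j$. Let $\bar u(r),\tilde u(r)$ be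 the variables after $r=0,1,2,\dots$ iterations. Then all their entries are positive, and the dual variables $\bar\lambda(r)=\varepsilon\log\bar u(r)$, $\tilde\lambda(r)=\varepsilon\log\tilde u(r)$ converge (R-)linearly to an optimal solution of the dual problem: there are a maximizer $(\bar\lambda^*,\tilde\lambda^*)$ of $\phi$ and constants $K$ and $0<\rho<1$ such that $$\big\|(\bar\lambda(r),\tilde\lambda(r))-(\bar\lambda^*,\tilde\lambda^*)\big\|\le K\rho^r\qquad\text{for all } r\ge 0 .$$ -/

import Mathlib

open scoped ENNReal

namespace TGOSPA

noncomputable section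

/-- Data of a TGOSPA problem with time steps `Fin (S + 1)` (so the number of time steps is
`T = S + 1 ≥ 1`): `m` ground-truth trajectories `X` and `n` estimated trajectories `Y` with states
in `E`, where `none` is the empty state and `some x` the singleton `{x}`; the exponent `p`, the
track-switch penalty `γ`, the cut-off `c` and the regularization parameter `ε`. -/
structure Problem (E : Type*) (m n S : ℕ) where
  X : Fin m → Fin (S + 1) → Option E
  Y : Fin n → Fin (S + 1) → Option E
  p : ℝ
  γ : ℝ
  c : ℝ
  ε : ℝ

/-- Positions `(i, j)` in an `(m + 1) × (n + 1)` assignment matrix. The last row and the last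
column stand for "unassigned". -/
abbrev Pos (m n : ℕ) : Type := Fin (m + 1) × Fin (n + 1)

/-- Multi-indices `(i₁, j₁), …, (i_T, j_T)` of the transport tensors. -/
abbrev Path (m n S : ℕ) : Type := Fin (S + 1) → Pos m n

/-- A family of row vectors (indexed by `Fin (m + 1)`) and a family of column vectors (indexed by
`Fin (n + 1)`), one of each for every time step: the type of the dual variables `(lam-bar,
lam-tilde)` and of the transformed variables `(u-bar, u-tilde)`. -/
abbrev Duals (m n S : ℕ) : Type :=
  (Fin (S + 1) → Fin (m + 1) → ℝ) × (Fin (S + 1) → Fin (n + 1) → ℝ)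

/-- `exp (-c / ε)` for a cost `c ∈ [0, ∞]`, with `exp (-∞) = 0`. -/
def gibbs (ε : ℝ) (c : ℝ≥0∞) : ℝ :=
  if c = ⊤ then 0 else Real.exp (-c.toReal / ε)

/-- The Kronecker delta. -/
def kron {ι : Type*} [DecidableEq ι] (a b : ι) : ℝ := if a = b then 1 else 0

/-- Row marginal `(1, …, 1, n)`. -/
def rowMarginal (m n : ℕ) : Fin (m + 1) → ℝ :=
  Fin.snoc (α := fun _ => ℝ) (fun _ => 1) (n : ℝ)

/-- Column marginal `(1, …, 1, m)`. -/
def colMarginal (m n : ℕ) : Fin (n + 1) → ℝ :=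
  Fin.snoc (α := fun _ => ℝ) (fun _ => 1) (m : ℝ)

namespace Problem

variable {E : Type*} [NormedAddCommGroup E] {m n S : ℕ}

/-- State of ground truth `i` at time `t`; row `m + 1` is always empty. -/
def xState (Q : Problem E m n S) (t : Fin (S + 1)) : Fin (m + 1) → Option E :=
  Fin.snoc (α := fun _ => Option E) (fun i => Q.X i t) none

/-- State of estimate `j` at time `t`; column `n + 1` is always empty. -/
def yState (Q : Problem E m n S) (t : Fin (S + 1)) : Fin (n + 1) → Option E :=
  Fin.snoc (α := fun _ => Option E) (fun j => Q.Y j t) none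

/-- The `p`-th root of the localization cost of a pair of (possibly empty) states. -/
def baseDist (Q : Problem E m n S) : Option E → Option E → ℝ
  | some x, some y => min ‖x - y‖ Q.c
  | none, none => 0
  | _, _ => Q.c / (2 : ℝ) ^ (1 / Q.p)

/-- The localization costs `D^t_{(i,j)}`. -/
def D (Q : Problem E m n S) (t : Fin (S + 1)) (z : Pos m n) : ℝ :=
  (Q.baseDist (Q.xState t z.1) (Q.yState t z.2)) ^ Q.p

/-- The switching costs `F_{(i,j),(k,l)}`, infinite if `i ≠ k`. -/
def F (Q : Problem E m n S) (z w : Pos m n) : ℝ≥0∞ :=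
  if z.1 = w.1 then
    ENNReal.ofReal (Q.γ ^ Q.p / 2 * (1 - kron z.1 w.1 * kron z.2 w.2) *
      ((1 - kron w.1 (Fin.last m)) * (1 - kron w.2 (Fin.last n)) +
        (1 - kron z.1 (Fin.last m)) * (1 - kron z.2 (Fin.last n))))
  else ⊤

/-- The cost tensor `C`. -/
def C (Q : Problem E m n S) (z : Path m n S) : ℝ≥0∞ :=
  ∑ t : Fin (S + 1), ENNReal.ofReal (Q.D t (z t)) +
    ∑ t : Fin S, Q.F (z t.castSucc) (z t.succ)

/-- The objective function `φ` of the dual of the entropy-regularized problem. -/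
def dualObj (Q : Problem E m n S) (lam : Duals m n S) : ℝ :=
  (-Q.ε * ∑ z : Path m n S,
      gibbs Q.ε (Q.C z) * (∏ t, Real.exp (lam.1 t (z t).1 / Q.ε)) *
        (∏ t, Real.exp (lam.2 t (z t).2 / Q.ε))
    + ∑ t, ∑ i, rowMarginal m n i * lam.1 t i
    + ∑ t, ∑ j, colMarginal m n j * lam.2 t j)
  + Q.ε * ((m : ℝ) + 1) ^ (S + 1) * ((n : ℝ) + 1) ^ (S + 1)

/-- `lam` is an optimal solution of the dual problem: it maximizes `φ` over all of `Duals`. -/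
def IsDualOptimal (Q : Problem E m n S) (lam : Duals m n S) : Prop :=
  ∀ lam' : Duals m n S, Q.dualObj lam' ≤ Q.dualObj lam

/-! ### The block coordinate ascent algorithm -/

/-- `k^t_{(i,j)} = exp (-D^t_{(i,j)} / ε)`. -/
def k (Q : Problem E m n S) (t : Fin (S + 1)) (z : Pos m n) : ℝ :=
  Real.exp (-Q.D t z / Q.ε)

/-- `k-hat_{(i,j),(k,l)} = exp (-F_{(i,j),(k,l)} / ε)`. -/
def khat (Q : Problem E m n S) (z w : Pos m n) : ℝ :=
  gibbs Q.ε (Q.F z w)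

/-- The backward messages, computed from the last time step down to the first one. -/
def backward (Q : Problem E m n S) (u : Duals m n S) (t : Fin (S + 1)) : Pos m n → ℝ :=
  Fin.reverseInduction (motive := fun _ => Pos m n → ℝ) (fun _ => 1)
    (fun s Φ z => ∑ w : Pos m n,
      Φ w * Q.k s.succ w * Q.khat z w * u.1 s.succ w.1 * u.2 s.succ w.2) t

/-- The projection on time step `t` as the algorithm computes it, from the forward message `R` and
the backward message `L` at time `t`. -/
def proj (Q : Problem E m n S) (R L : Pos m n → ℝ) (u : Duals m n S) (t : Fin (S + 1))
    (z : Pos m n) : ℝ :=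
  R z * Q.k t z * u.1 t z.1 * u.2 t z.2 * L z

/-- Update of the row vector at time `t`. -/
def updateRow (Q : Problem E m n S) (R L : Pos m n → ℝ) (t : Fin (S + 1)) (u : Duals m n S) :
    Duals m n S :=
  (Function.update u.1 t fun i =>
    rowMarginal m n i / (∑ j, Q.proj R L u t (i, j)) * u.1 t i, u.2)

/-- Update of the column vector at time `t`. -/
def updateCol (Q : Problem E m n S) (R L : Pos m n → ℝ) (t : Fin (S + 1)) (u : Duals m n S) :
    Duals m n S :=
  (u.1, Function.update u.2 t fun j =>
    colMarginal m n j / (∑ i, Q.proj R L u t (i, j)) * u.2 t j)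

/-- The row update at time `t`, followed by the column update at time `t`. -/
def updateAt (Q : Problem E m n S) (R L : Pos m n → ℝ) (t : Fin (S + 1)) (u : Duals m n S) :
    Duals m n S :=
  Q.updateCol R L t (Q.updateRow R L t u)

/-- The forward message at time `t + 1` from the forward message `R` at time `t`. -/
def forwardStep (Q : Problem E m n S) (R : Pos m n → ℝ) (t : Fin (S + 1)) (u : Duals m n S) :
    Pos m n → ℝ :=
  fun w => ∑ z : Pos m n, R z * Q.k t z * Q.khat z w * u.1 t z.1 * u.2 t z.2

/-- Body of the `for` loop over the time steps before the last one. The state of the loop is the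
pair of the current variables and the current forward message. -/
def loopBody (Q : Problem E m n S) (L : Fin (S + 1) → Pos m n → ℝ)
    (st : Duals m n S × (Pos m n → ℝ)) (t : Fin S) : Duals m n S × (Pos m n → ℝ) :=
  let u' := Q.updateAt st.2 (L t.castSucc) t.castSucc st.1
  (u', Q.forwardStep st.2 t.castSucc u')

/-- One pass of the `while` loop: compute all the backward messages, run through all time steps but
the last in increasing order, and update at the last time step. -/
def sweep (Q : Problem E m n S) (u : Duals m n S) : Duals m n S :=
  let L := Q.backward u
  let st := Fin.foldl S (Q.loopBody L) (u, fun _ => 1)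
  Q.updateAt st.2 (L (Fin.last S)) (Fin.last S) st.1

/-- The variables `(u-bar, u-tilde)` after `r` passes of the algorithm, started from all ones. -/
def iter (Q : Problem E m n S) (r : ℕ) : Duals m n S :=
  Q.sweep^[r] (fun _ _ => 1, fun _ _ => 1)

/-- The dual variables `ε log u` that belong to the transformed variables `u`. -/
def toDual (Q : Problem E m n S) (u : Duals m n S) : Duals m n S :=
  (fun t i => Q.ε * Real.log (u.1 t i), fun t j => Q.ε * Real.log (u.2 t j))

end Problem

/-- Linear convergence of the sequence `x` to `a`: the error is at most a constant times a
geometric sequence of ratio less than one. -/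
def ConvergesLinearly {V : Type*} [NormedAddCommGroup V] (x : ℕ → V) (a : V) : Prop :=
  ∃ K ρ : ℝ, 0 < ρ ∧ ρ < 1 ∧ ∀ r : ℕ, ‖x r - a‖ ≤ K * ρ ^ r

end

end TGOSPA

/-! Switching rows costs infinity, so only paths with a constant row carry positive Gibbs weight.
Let `A` (`pathSum`) add up the scaled duals `x = lam / ε` along each such path. The product plan
`feasiblePlan` is strictly positive and has the prescribed marginals, so the linear part of the dual
is the sum over paths `z` of `b_z (A x)_z` with `b > 0`. Up to the factor `-ε` and a constant, the
dual objective is then `expObj`, the sum of `a_z exp (A x)_z - b_z (A x)_z` with `a, b > 0`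
(`dualObj_eq`).

Such a function is coercive in `A x`, hence on each sublevel set strongly convex and with Lipschitz
gradient, both measured in `‖A x‖`. `A` has a kernel on the whole space, since constants can move
between row and column vectors, but it is injective on each single block (`norm_le_of_mem_block`).
Thus an exact block step is controlled in the norm of the duals by the square root of its decrease.
Over a sweep visiting every block, the final gradient is controlled by the decrease too
(`exists_blockPath_bound`). Together with `exists_gradient_domination` this makes the optimality gap
contract geometrically. The steps then shrink geometrically as well, so the iterates are Cauchy and
converge to one minimizer even though minimizers are not unique
(`exists_convergesLinearly_of_blockPath`).

It remains to see that the algorithm performs exact block steps. Forward and backward messages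
compute the marginals of the current tensor (`sum_proj`), an update rescales one block so that its
marginal becomes the prescribed one, and messages stay valid because they depend only on strictly
earlier or strictly later times (`sweep_invariant`). -/

namespace TGOSPA

open Filter Topology

/-! ### Convexity, smoothness and coercivity of sums of exponentials. -/

section ExpObjective

/-- Quantitative strong convexity of the exponential on a bounded interval. -/
lemma exp_strongly_convex {s t R : ℝ} (hs : |s| ≤ R) (ht : |t| ≤ R) :
    Real.exp (-R) / 4 * (s - t) ^ 2 ≤ Real.exp s - Real.exp t - Real.exp t * (s - t) := by
  -- With `X = exp (s/2)` and `Y = exp (t/2)`, the right-hand side is `(X - Y)² + Y (2 (X - Y) - Y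
  -- (s - t))`. The second term is nonnegative by the tangent inequality `X ≥ Y (1 + (s - t)/2)`,
  -- and `key` bounds the square from below.
  have key : ∀ {a b : ℝ}, |b| ≤ R → b ≤ a →
      Real.exp (-R) / 4 * (a - b) ^ 2 ≤ (Real.exp (a / 2) - Real.exp (b / 2)) ^ 2 := by
    intro a b hb hab
    have h1 : Real.exp (b / 2) * (1 + (a - b) / 2) ≤ Real.exp (a / 2) := by
      have h := Real.add_one_le_exp ((a - b) / 2)
      have e : Real.exp (a / 2) = Real.exp (b / 2) * Real.exp ((a - b) / 2) := by
        rw [← Real.exp_add]; ring_nf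
      rw [e]
      gcongr
      linarith
    have h2 : 0 ≤ Real.exp (b / 2) * ((a - b) / 2) := by
      have := Real.exp_pos (b / 2)
      have : 0 ≤ (a - b) / 2 := by linarith
      positivity
    have h3 : (Real.exp (b / 2) * ((a - b) / 2)) ^ 2 ≤
        (Real.exp (a / 2) - Real.exp (b / 2)) ^ 2 := by
      gcongr
      linarith
    have h4 : Real.exp (-R) ≤ Real.exp b := Real.exp_le_exp.2 (abs_le.1 hb).1
    have h5 : Real.exp b = Real.exp (b / 2) ^ 2 := by
      rw [sq, ← Real.exp_add]; ring_nf
    calc Real.exp (-R) / 4 * (a - b) ^ 2 ≤ Real.exp b / 4 * (a - b) ^ 2 := by gcongr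
      _ = (Real.exp (b / 2) * ((a - b) / 2)) ^ 2 := by rw [h5]; ring
      _ ≤ _ := h3
  have h1 : Real.exp (-R) / 4 * (s - t) ^ 2 ≤ (Real.exp (s / 2) - Real.exp (t / 2)) ^ 2 := by
    rcases le_total t s with h | h
    · exact key ht h
    · have := key hs h
      nlinarith [this]
  have h2 : Real.exp (t / 2) * (1 + (s - t) / 2) ≤ Real.exp (s / 2) := by
    have h := Real.add_one_le_exp ((s - t) / 2)
    have e : Real.exp (s / 2) = Real.exp (t / 2) * Real.exp ((s - t) / 2) := by
      rw [← Real.exp_add]; ring_nf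
    rw [e]
    gcongr
    linarith
  have e1 : Real.exp s = Real.exp (s / 2) ^ 2 := by rw [sq, ← Real.exp_add]; ring_nf
  have e2 : Real.exp t = Real.exp (t / 2) ^ 2 := by rw [sq, ← Real.exp_add]; ring_nf
  rw [e1, e2]
  nlinarith [mul_le_mul_of_nonneg_left h2 (Real.exp_pos (t / 2)).le]

lemma abs_exp_sub_exp_le {s t R : ℝ} (hs : |s| ≤ R) (ht : |t| ≤ R) :
    |Real.exp s - Real.exp t| ≤ Real.exp R * |s - t| := by
  have key : ∀ {a b : ℝ}, |a| ≤ R → b ≤ a →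
      Real.exp a - Real.exp b ≤ Real.exp R * (a - b) := by
    intro a b ha hab
    have h := Real.add_one_le_exp (b - a)
    have e : Real.exp b = Real.exp a * Real.exp (b - a) := by rw [← Real.exp_add]; ring_nf
    have h4 : Real.exp a ≤ Real.exp R := Real.exp_le_exp.2 (abs_le.1 ha).2
    have h5 : Real.exp a * (b - a + 1) ≤ Real.exp b := by rw [e]; gcongr
    nlinarith [mul_le_mul_of_nonneg_right h4 (sub_nonneg.2 hab)]
  rcases le_total t s with h | h
  · rw [abs_of_nonneg (sub_nonneg.2 (Real.exp_le_exp.2 h)), abs_of_nonneg (sub_nonneg.2 h)]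
    exact key hs h
  · rw [abs_sub_comm, abs_sub_comm s,
      abs_of_nonneg (sub_nonneg.2 (Real.exp_le_exp.2 h)), abs_of_nonneg (sub_nonneg.2 h)]
    exact key ht h

/-- Coercivity of `s ↦ a e^s - b s`. -/
lemma mul_abs_sub_le_mul_exp_sub {a b : ℝ} (ha : 0 < a) (hb : 0 < b) (s : ℝ) :
    b * |s| - 2 * b * |Real.log (2 * b / a) - 1| ≤ a * Real.exp s - b * s := by
  set l := Real.log (2 * b / a) with hl
  rcases le_total 0 s with h | h
  · rw [abs_of_nonneg h]
    -- The shift `l` makes the tangent line at `s = l` have slope `2 * b`, so subtracting `b * s`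
    -- still leaves growth `b * s`.
    have e : a * Real.exp s = 2 * b * Real.exp (s - l) := by
      rw [Real.exp_sub, hl, Real.exp_log (by positivity)]
      field_simp
    have h1 := Real.add_one_le_exp (s - l)
    have h2 := le_abs_self (l - 1)
    rw [e]
    nlinarith
  · rw [abs_of_nonpos h]
    have := abs_nonneg (l - 1)
    have := Real.exp_pos s
    have : 0 ≤ a * Real.exp s := by positivity
    have : 0 ≤ 2 * b * |l - 1| := by positivity
    linarith

variable {V Z : Type*} [NormedAddCommGroup V] [NormedSpace ℝ V] [Fintype Z]

/-- The convex function `x ↦ ∑ z, (a_z exp (A x)_z - b_z (A x)_z)`. -/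
noncomputable def expObj (A : V →ₗ[ℝ] Z → ℝ) (a b : Z → ℝ) (x : V) : ℝ :=
  ∑ z, (a z * Real.exp (A x z) - b z * A x z)

/-- The derivative of `expObj` at `x`. -/
noncomputable def expGrad (A : V →ₗ[ℝ] Z → ℝ) (a b : Z → ℝ) (x : V) : V →ₗ[ℝ] ℝ :=
  ∑ z, (a z * Real.exp (A x z) - b z) • (LinearMap.proj z ∘ₗ A)

lemma expGrad_apply (A : V →ₗ[ℝ] Z → ℝ) (a b : Z → ℝ) (x d : V) :
    expGrad A a b x d = ∑ z, (a z * Real.exp (A x z) - b z) * A d z := by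
  simp [expGrad, LinearMap.sum_apply]

variable {A : V →ₗ[ℝ] Z → ℝ} {a b : Z → ℝ}

/-- Every summand is coercive in its own coordinate of `A x`. Only `A x` is bounded, not `x`,
because `expObj` is constant along the kernel of `A`. -/
lemma exists_bound_of_expObj_le (ha : ∀ z, 0 < a z) (hb : ∀ z, 0 < b z) (c : ℝ) :
    ∃ R : ℝ, ∀ x, expObj A a b x ≤ c → ∀ z, |A x z| ≤ R := by
  set K : Z → ℝ := fun z => 2 * b z * |Real.log (2 * b z / a z) - 1| with hK
  have hK0 : ∀ z, 0 ≤ K z := fun z => by have := hb z; positivity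
  -- A sum of absolute values serves as a bound uniform in `z`, with no maximum over a possibly
  -- empty `Z`.
  refine ⟨∑ z, |(c + ∑ w, K w) / b z|, fun x hx z => ?_⟩
  have h1 : ∑ w, (b w * |A x w| - K w) ≤ c :=
    (Finset.sum_le_sum fun w _ => mul_abs_sub_le_mul_exp_sub (ha w) (hb w) _).trans hx
  rw [Finset.sum_sub_distrib] at h1
  have h2 : b z * |A x z| ≤ ∑ w, b w * |A x w| :=
    Finset.single_le_sum (f := fun w => b w * |A x w|)
      (fun w _ => mul_nonneg (hb w).le (abs_nonneg _)) (Finset.mem_univ z)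
  have h3 : |A x z| ≤ (c + ∑ w, K w) / b z := by
    rw [le_div_iff₀ (hb z)]; linarith
  exact (h3.trans (le_abs_self _)).trans
    (Finset.single_le_sum (f := fun z => |(c + ∑ w, K w) / b z|)
      (fun w _ => abs_nonneg _) (Finset.mem_univ z))

lemma exists_expObj_strongly_convex (ha : ∀ z, 0 < a z) (R : ℝ) :
    ∃ σ : ℝ, 0 < σ ∧ ∀ x y : V, (∀ z, |A x z| ≤ R) → (∀ z, |A y z| ≤ R) →
      expGrad A a b y (x - y) + σ * ‖A (x - y)‖ ^ 2 ≤ expObj A a b x - expObj A a b y := by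
  obtain ⟨a₀, ha₀, hle⟩ : ∃ a₀ : ℝ, 0 < a₀ ∧ ∀ z, a₀ ≤ a z := by
    rcases isEmpty_or_nonempty Z with h | h
    · exact ⟨1, one_pos, fun z => h.elim z⟩
    · obtain ⟨z, hz⟩ := Finite.exists_min a
      exact ⟨a z, ha z, hz⟩
  refine ⟨a₀ * (Real.exp (-R) / 4), by have := Real.exp_pos (-R); positivity,
    fun x y hx hy => ?_⟩
  have h1 : ‖A (x - y)‖ ^ 2 ≤ ∑ z, (A (x - y) z) ^ 2 := by
    have hn : 0 ≤ ∑ z, (A (x - y) z) ^ 2 := Finset.sum_nonneg fun z _ => sq_nonneg _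
    rw [← Real.sq_sqrt hn]
    gcongr
    rw [pi_norm_le_iff_of_nonneg (Real.sqrt_nonneg _)]
    intro z
    rw [Real.norm_eq_abs]
    apply Real.abs_le_sqrt
    exact Finset.single_le_sum (f := fun z => (A (x - y) z) ^ 2) (fun w _ => sq_nonneg _)
      (Finset.mem_univ z)
  have hσ : 0 ≤ a₀ * (Real.exp (-R) / 4) := by have := Real.exp_pos (-R); positivity
  calc _ ≤ expGrad A a b y (x - y) + a₀ * (Real.exp (-R) / 4) * ∑ z, (A (x - y) z) ^ 2 := by
        gcongr
    _ = ∑ z, ((a z * Real.exp (A y z) - b z) * (A x z - A y z) +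
          a₀ * (Real.exp (-R) / 4 * (A x z - A y z) ^ 2)) := by
        rw [expGrad_apply, Finset.mul_sum, ← Finset.sum_add_distrib]
        refine Finset.sum_congr rfl fun z _ => ?_
        rw [map_sub, Pi.sub_apply]; ring
    _ ≤ ∑ z, ((a z * Real.exp (A x z) - b z * A x z) -
          (a z * Real.exp (A y z) - b z * A y z)) := by
        refine Finset.sum_le_sum fun z _ => ?_
        have h := exp_strongly_convex (hx z) (hy z)
        have h0 : 0 ≤ Real.exp (-R) / 4 * (A x z - A y z) ^ 2 := by
          have := Real.exp_pos (-R); positivity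
        have h2 : a₀ * (Real.exp (-R) / 4 * (A x z - A y z) ^ 2) ≤
            a z * (Real.exp (A x z) - Real.exp (A y z) - Real.exp (A y z) * (A x z - A y z)) :=
          mul_le_mul (hle z) h h0 (ha z).le
        linarith
    _ = _ := by rw [Finset.sum_sub_distrib]; rfl

lemma exists_expGrad_lipschitz (ha : ∀ z, 0 < a z) (R : ℝ) :
    ∃ L : ℝ, 0 < L ∧ ∀ x y : V, (∀ z, |A x z| ≤ R) → (∀ z, |A y z| ≤ R) → ∀ d,
      |expGrad A a b x d - expGrad A a b y d| ≤ L * ‖A (x - y)‖ * ‖A d‖ := by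
  refine ⟨1 + ∑ z, a z * Real.exp R, ?_, fun x y hx hy d => ?_⟩
  · have : 0 ≤ ∑ z, a z * Real.exp R :=
      Finset.sum_nonneg fun z _ => mul_nonneg (ha z).le (Real.exp_pos _).le
    linarith
  · rw [expGrad_apply, expGrad_apply, ← Finset.sum_sub_distrib]
    calc _ ≤ ∑ z, a z * Real.exp R * (‖A (x - y)‖ * ‖A d‖) := by
          refine (Finset.abs_sum_le_sum_abs _ _).trans (Finset.sum_le_sum fun z _ => ?_)
          have e : (a z * Real.exp (A x z) - b z) * A d z - (a z * Real.exp (A y z) - b z) * A d z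
              = a z * (Real.exp (A x z) - Real.exp (A y z)) * A d z := by ring
          rw [e, abs_mul, abs_mul, abs_of_pos (ha z), mul_assoc, mul_assoc]
          have h1 := abs_exp_sub_exp_le (hx z) (hy z)
          have h2 : |A x z - A y z| ≤ ‖A (x - y)‖ := by
            have := norm_le_pi_norm (A (x - y)) z
            rwa [map_sub, Pi.sub_apply, Real.norm_eq_abs, ← map_sub] at this
          have h3 : |A d z| ≤ ‖A d‖ := norm_le_pi_norm (A d) z
          have h4 : |Real.exp (A x z) - Real.exp (A y z)| ≤ Real.exp R * ‖A (x - y)‖ :=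
            h1.trans (by gcongr)
          have := (ha z).le
          calc a z * (|Real.exp (A x z) - Real.exp (A y z)| * |A d z|)
              ≤ a z * ((Real.exp R * ‖A (x - y)‖) * ‖A d‖) := by gcongr
            _ = _ := by ring
      _ = (∑ z, a z * Real.exp R) * ‖A (x - y)‖ * ‖A d‖ := by
          rw [← Finset.sum_mul]; ring
      _ ≤ _ := by gcongr; linarith

lemma continuous_expObj [FiniteDimensional ℝ V] : Continuous (expObj A a b) := by
  have hA : Continuous A := A.continuous_of_finiteDimensional
  unfold expObj
  fun_prop

/-- A linear map into a finite product has a bounded right inverse on its range. -/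
lemma exists_bounded_preimage [FiniteDimensional ℝ V] (A : V →ₗ[ℝ] Z → ℝ) :
    ∃ κ : ℝ, 0 < κ ∧ ∀ x : V, ∃ y : V, A y = A x ∧ ‖y‖ ≤ κ * ‖A x‖ := by
  obtain ⟨g, hg⟩ := A.rangeRestrict.exists_rightInverse_of_surjective A.range_rangeRestrict
  refine ⟨‖LinearMap.toContinuousLinearMap g‖ + 1, by positivity, fun x =>
    ⟨g (A.rangeRestrict x), ?_, ?_⟩⟩
  · have := congrArg Subtype.val (LinearMap.congr_fun hg (A.rangeRestrict x))
    simpa using this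
  · have h := (LinearMap.toContinuousLinearMap g).le_opNorm (A.rangeRestrict x)
    have h2 : ‖A.rangeRestrict x‖ = ‖A x‖ := rfl
    rw [h2] at h
    have := norm_nonneg (A x)
    simp only [LinearMap.coe_toContinuousLinearMap'] at h
    nlinarith

/-- The objective factors through `A`, so each point of a sublevel set can be traded for a preimage
of bounded norm with the same value. Minimizing over a compact ball therefore suffices. -/
lemma exists_expObj_min [FiniteDimensional ℝ V] (ha : ∀ z, 0 < a z) (hb : ∀ z, 0 < b z) :
    ∃ x₀, ∀ x, expObj A a b x₀ ≤ expObj A a b x := by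
  obtain ⟨R, hR⟩ := exists_bound_of_expObj_le (A := A) ha hb (expObj A a b 0)
  obtain ⟨κ, hκ, hpre⟩ := exists_bounded_preimage A
  obtain ⟨x₀, hx₀, hmin⟩ := (isCompact_closedBall (0 : V) (κ * |R|)).exists_isMinOn
    ⟨0, by simp only [Metric.mem_closedBall, dist_self]; positivity⟩
    (continuous_expObj (A := A) (a := a) (b := b)).continuousOn
  refine ⟨x₀, fun x => ?_⟩
  have hmin' := isMinOn_iff.1 hmin
  rcases le_total (expObj A a b x) (expObj A a b 0) with h | h
  · obtain ⟨y, hy, hyn⟩ := hpre x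
    have e : expObj A a b x = expObj A a b y := by simp only [expObj, hy]
    rw [e]
    apply hmin'
    rw [mem_closedBall_zero_iff]
    refine hyn.trans ?_
    gcongr
    rw [pi_norm_le_iff_of_nonneg (abs_nonneg _)]
    exact fun z => (hR x h z).trans (le_abs_self _)
  · refine (hmin' 0 ?_).trans h
    simp only [Metric.mem_closedBall, dist_self]; positivity

/-! ### Exact block minimization. -/

/-- `y` arises from `x` by exact minimization of `expObj` along the subspace `W`. -/
def IsBlockStep (A : V →ₗ[ℝ] Z → ℝ) (a b : Z → ℝ) (W : Submodule ℝ V) (x y : V) : Prop :=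
  y - x ∈ W ∧ ∀ d ∈ W, expGrad A a b y d = 0

/-- `BlockPath A a b W k s x y`: `y` arises from `x` by `k` exact block minimizations, which cover
exactly the blocks in `s`. -/
inductive BlockPath {B : Type*} (A : V →ₗ[ℝ] Z → ℝ) (a b : Z → ℝ) (W : B → Submodule ℝ V) :
    ℕ → Set B → V → V → Prop
  | refl (x : V) : BlockPath A a b W 0 ∅ x x
  | step {k : ℕ} {s : Set B} {x y w : V} (i : B) (h : BlockPath A a b W k s x y)
      (hi : IsBlockStep A a b (W i) y w) : BlockPath A a b W (k + 1) (insert i s) x w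

variable {B : Type*} {W : B → Submodule ℝ V}

/-- In the strong convexity inequality based at `y`, the first-order term vanishes because `x - y`
lies in the block. -/
lemma IsBlockStep.sq_norm_le {σ R : ℝ} {U : Submodule ℝ V} {x y : V}
    (hσ : ∀ x y : V, (∀ z, |A x z| ≤ R) → (∀ z, |A y z| ≤ R) →
      expGrad A a b y (x - y) + σ * ‖A (x - y)‖ ^ 2 ≤ expObj A a b x - expObj A a b y)
    (h : IsBlockStep A a b U x y) (hx : ∀ z, |A x z| ≤ R) (hy : ∀ z, |A y z| ≤ R) :
    σ * ‖A (y - x)‖ ^ 2 ≤ expObj A a b x - expObj A a b y := by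
  have h1 := hσ x y hx hy
  have h2 : x - y ∈ U := by rw [← neg_sub]; exact U.neg_mem h.1
  rw [h.2 _ h2, zero_add, ← neg_sub, map_neg, norm_neg] at h1
  exact h1

/-- Here `R` is taken from the two points themselves. Monotonicity thus precedes, and justifies, the
use of one constant on a whole sublevel set. -/
lemma IsBlockStep.expObj_le {U : Submodule ℝ V} {x y : V} (ha : ∀ z, 0 < a z)
    (h : IsBlockStep A a b U x y) : expObj A a b y ≤ expObj A a b x := by
  set R := ‖A x‖ + ‖A y‖
  obtain ⟨σ, hσ, H⟩ := exists_expObj_strongly_convex (A := A) (b := b) ha R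
  have hx : ∀ z, |A x z| ≤ R := fun z =>
    (norm_le_pi_norm (A x) z).trans (le_add_of_nonneg_right (norm_nonneg _))
  have hy : ∀ z, |A y z| ≤ R := fun z =>
    (norm_le_pi_norm (A y) z).trans (le_add_of_nonneg_left (norm_nonneg _))
  have := h.sq_norm_le H hx hy
  have : 0 ≤ σ * ‖A (y - x)‖ ^ 2 := by positivity
  linarith

lemma BlockPath.expObj_le (ha : ∀ z, 0 < a z) {k : ℕ} {s : Set B} {x y : V}
    (h : BlockPath A a b W k s x y) : expObj A a b y ≤ expObj A a b x := by
  induction h with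
  | refl => exact le_rfl
  | step i h hi ih => exact (hi.expObj_le ha).trans ih

/-- After `k` block minimizations, the lengths of the steps and the derivative along the visited
blocks are controlled by the decrease of the objective. -/
lemma exists_blockPath_bound (ha : ∀ z, 0 < a z) (hb : ∀ z, 0 < b z) {κ : ℝ} (hκ : 0 < κ)
    (hW : ∀ i, ∀ d ∈ W i, ‖d‖ ≤ κ * ‖A d‖) (c : ℝ) (k : ℕ) :
    ∃ K : ℝ, 0 < K ∧ ∀ (s : Set B) (x y : V), BlockPath A a b W k s x y → expObj A a b x ≤ c →
      ∃ Δ : ℝ, 0 ≤ Δ ∧ Δ ^ 2 ≤ K * (expObj A a b x - expObj A a b y) ∧ ‖y - x‖ ≤ K * Δ ∧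
        ∀ i ∈ s, ∀ d ∈ W i, |expGrad A a b y d| ≤ K * Δ * ‖A d‖ := by
  obtain ⟨R, hR⟩ := exists_bound_of_expObj_le (A := A) ha hb c
  obtain ⟨σ, hσ, hconv⟩ := exists_expObj_strongly_convex (A := A) (b := b) ha R
  obtain ⟨L, hL, hlip⟩ := exists_expGrad_lipschitz (A := A) (b := b) ha R
  induction k with
  | zero =>
    refine ⟨1, one_pos, fun s x y h _ => ?_⟩
    cases h
    exact ⟨0, le_rfl, by simp, by simp, by simp⟩
  | succ k ih =>
    obtain ⟨K, hK, ih⟩ := ih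
    refine ⟨2 * K + 2 / σ + κ + L, by positivity, fun s x w h hx => ?_⟩
    cases h with
    | @step _ s _ y _ j h hj =>
    obtain ⟨Δ, hΔ, hsq, hdist, hgrad⟩ := ih s x y h hx
    have hyx := h.expObj_le ha
    have hwy := hj.expObj_le ha
    have hRy := hR y (hyx.trans hx)
    have hRw := hR w (hwy.trans (hyx.trans hx))
    have hstep := hj.sq_norm_le hconv hRy hRw
    set δ := ‖A (w - y)‖ with hδ
    have hδ0 : 0 ≤ δ := norm_nonneg _
    have hσ' : 0 < 2 / σ := by positivity
    have hδsq : δ ^ 2 ≤ 1 / σ * (expObj A a b y - expObj A a b w) := by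
      rw [one_div, ← div_eq_inv_mul, le_div_iff₀ hσ]; linarith
    set e₁ := expObj A a b x - expObj A a b y with he₁
    set e₂ := expObj A a b y - expObj A a b w with he₂
    have he : expObj A a b x - expObj A a b w = e₁ + e₂ := by rw [he₁, he₂]; ring
    have h1 : 0 ≤ e₁ := by linarith
    have h2 : 0 ≤ e₂ := by linarith
    -- `Δ` accumulates the step lengths measured through `A`. In the new constant, `2 * K` and `2 /
    -- σ` absorb `(Δ + δ)² ≤ 2 Δ² + 2 δ²`, `κ` turns `δ` into a distance, and `L` accounts for the
    -- change of gradient.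
    refine ⟨Δ + δ, by positivity, ?_, ?_, ?_⟩
    · rw [he]
      have hs : (Δ + δ) ^ 2 ≤ 2 * Δ ^ 2 + 2 * δ ^ 2 := by nlinarith [sq_nonneg (Δ - δ)]
      have e : 2 * (1 / σ * e₂) = 2 / σ * e₂ := by ring
      have : 0 ≤ (2 * K + κ + L) * e₂ := by positivity
      have : 0 ≤ (2 / σ + κ + L) * e₁ := by positivity
      linarith
    · have hwy' := hW j _ hj.1
      have e : w - x = (w - y) + (y - x) := by abel
      rw [e]
      refine (norm_add_le _ _).trans ?_
      have : 0 ≤ (K + 2 / σ + κ + L) * Δ := by positivity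
      have : 0 ≤ (2 * K + 2 / σ + L) * δ := by positivity
      linarith
    · intro i hi d hd
      have hl := hlip w y hRw hRy d
      have hAd : 0 ≤ ‖A d‖ := norm_nonneg _
      -- The derivative vanishes along the block just minimized. Along earlier blocks it has moved
      -- by at most `L * δ * ‖A d‖`.
      rcases hi with rfl | hi
      · rw [hj.2 d hd, abs_zero]; positivity
      · have hg := hgrad i hi d hd
        have ht : |expGrad A a b w d| ≤
            |expGrad A a b w d - expGrad A a b y d| + |expGrad A a b y d| := by
          simpa using abs_add_le (expGrad A a b w d - expGrad A a b y d) (expGrad A a b y d)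
        have : 0 ≤ (K + 2 / σ + κ + L) * Δ * ‖A d‖ := by positivity
        have : 0 ≤ (2 * K + 2 / σ + κ) * δ * ‖A d‖ := by positivity
        linarith

/-! ### Gradient domination and the linear rate. -/

/-- Gradient domination: the optimality gap is at most quadratic in the size of the derivative. -/
lemma exists_gradient_domination [FiniteDimensional ℝ V] (ha : ∀ z, 0 < a z) (hb : ∀ z, 0 < b z)
    (c : ℝ) : ∃ K : ℝ, 0 < K ∧ ∀ x x₀ : V, (∀ y, expObj A a b x₀ ≤ expObj A a b y) →
      expObj A a b x ≤ c → ∀ g : ℝ, (∀ d, |expGrad A a b x d| ≤ g * ‖d‖) →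
      expObj A a b x - expObj A a b x₀ ≤ K * g ^ 2 := by
  obtain ⟨R, hR⟩ := exists_bound_of_expObj_le (A := A) ha hb c
  obtain ⟨σ, hσ, hconv⟩ := exists_expObj_strongly_convex (A := A) (b := b) ha R
  obtain ⟨κ, hκ, hpre⟩ := exists_bounded_preimage A
  refine ⟨κ ^ 2 / (4 * σ), by positivity, fun x x₀ hx₀ hx g hg => ?_⟩
  have h1 := hconv x₀ x (hR x₀ ((hx₀ x).trans hx)) (hR x hx)
  -- The derivative in direction `d` depends only on `A d`, so `x₀ - x`, whose norm `A` does not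
  -- control, may be replaced by a short preimage `y`.
  obtain ⟨y, hy, hyn⟩ := hpre (x₀ - x)
  have e : expGrad A a b x (x₀ - x) = expGrad A a b x y := by
    rw [expGrad_apply, expGrad_apply, hy]
  rw [e] at h1
  have h2 := (abs_le.1 (hg y)).1
  set η := ‖A (x₀ - x)‖
  have hgn : g * ‖y‖ ≤ |g| * (κ * η) :=
    mul_le_mul (le_abs_self g) hyn (norm_nonneg _) (abs_nonneg _)
  -- Completing the square: the left side is the maximum of `|g| κ η - σ η²` over `η`.
  have e2 : κ ^ 2 / (4 * σ) * g ^ 2 =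
      |g| * (κ * η) - σ * η ^ 2 + (σ * η - |g| * κ / 2) ^ 2 / σ := by
    rw [← sq_abs g]; field_simp; ring
  have : 0 ≤ (σ * η - |g| * κ / 2) ^ 2 / σ := by positivity
  linarith

/-- Cyclic exact block minimization of `expObj` converges R-linearly to a minimizer. -/
theorem exists_convergesLinearly_of_blockPath [FiniteDimensional ℝ V] [Fintype B]
    (ha : ∀ z, 0 < a z) (hb : ∀ z, 0 < b z) {κ : ℝ} (hκ : 0 < κ)
    (hW : ∀ i, ∀ d ∈ W i, ‖d‖ ≤ κ * ‖A d‖)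
    (hdecomp : ∀ d : V, ∃ e : B → V, (∀ i, e i ∈ W i) ∧ ∑ i, e i = d ∧ ∀ i, ‖e i‖ ≤ ‖d‖)
    (k : ℕ) (x : ℕ → V) (hx : ∀ r, BlockPath A a b W k Set.univ (x r) (x (r + 1))) :
    ∃ x₀, (∀ y, expObj A a b x₀ ≤ expObj A a b y) ∧ ConvergesLinearly x x₀ := by
  obtain ⟨xm, hxm⟩ := exists_expObj_min (A := A) ha hb
  set f := expObj A a b with hf
  have hanti : ∀ r, f (x r) ≤ f (x 0) := by
    intro r
    induction r with
    | zero => exact le_rfl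
    | succ r ih => exact ((hx r).expObj_le ha).trans ih
  obtain ⟨K, hK, hpath⟩ := exists_blockPath_bound ha hb hκ hW (f (x 0)) k
  obtain ⟨G, hG, hdom⟩ := exists_gradient_domination (A := A) ha hb (f (x 0))
  set N := ‖LinearMap.toContinuousLinearMap A‖ with hN
  have hAn : ∀ d, ‖A d‖ ≤ N * ‖d‖ := fun d => (LinearMap.toContinuousLinearMap A).le_opNorm d
  have hN0 : 0 ≤ N := norm_nonneg _
  set β : ℝ := (Fintype.card B : ℝ) with hβ
  have hβ0 : 0 ≤ β := Nat.cast_nonneg _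
  -- `β * K * N * Δ` bounds the full gradient, as a direction splits into `β` block components; the
  -- `+ 1` ensures `M > 0`.
  set M : ℝ := G * (β * K * N) ^ 2 * K + 1 with hM
  have hM0 : 0 < M := by positivity
  have hone : ∀ r, f (x (r + 1)) - f xm ≤ M * (f (x r) - f (x (r + 1))) ∧
      ‖x (r + 1) - x r‖ ^ 2 ≤ K ^ 3 * (f (x r) - f (x (r + 1))) := by
    intro r
    obtain ⟨Δ, hΔ, hsq, hdist, hgrad⟩ := hpath _ _ _ (hx r) (hanti r)
    constructor
    · have hg : ∀ d, |expGrad A a b (x (r + 1)) d| ≤ (β * K * N * Δ) * ‖d‖ := by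
        intro d
        obtain ⟨e, he, hsum, hen⟩ := hdecomp d
        rw [← hsum, map_sum, hsum]
        refine (Finset.abs_sum_le_sum_abs _ _).trans ?_
        calc _ ≤ ∑ _i : B, K * Δ * (N * ‖d‖) := by
              refine Finset.sum_le_sum fun i _ => ?_
              refine (hgrad i (Set.mem_univ i) _ (he i)).trans ?_
              have := (hAn (e i)).trans (mul_le_mul_of_nonneg_left (hen i) hN0)
              gcongr
          _ = _ := by rw [Finset.sum_const, Finset.card_univ, nsmul_eq_mul]; ring
      have h1 := hdom _ xm hxm (hanti (r + 1)) _ hg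
      have h2 : G * (β * K * N * Δ) ^ 2 = G * (β * K * N) ^ 2 * Δ ^ 2 := by ring
      have h3 : G * (β * K * N) ^ 2 * Δ ^ 2 ≤
          G * (β * K * N) ^ 2 * (K * (f (x r) - f (x (r + 1)))) := by gcongr
      have h4 := (hx r).expObj_le ha
      rw [hM]
      linarith
    · calc ‖x (r + 1) - x r‖ ^ 2 ≤ (K * Δ) ^ 2 := by gcongr
        _ = K ^ 2 * Δ ^ 2 := by ring
        _ ≤ K ^ 2 * (K * (f (x r) - f (x (r + 1)))) := by gcongr
        _ = _ := by ring
  -- If `e r` is the optimality gap, `e (r+1) ≤ M (e r - e (r+1))` rearranges to `e (r+1) ≤ q * e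
  -- r`.
  set q : ℝ := M / (1 + M) with hq
  have hq0 : 0 < q := by positivity
  have hq1 : q < 1 := by rw [hq, div_lt_one (by positivity)]; linarith
  set E : ℝ := f (x 0) - f xm with hE
  have hgap : ∀ r, f (x r) - f xm ≤ E * q ^ r := by
    intro r
    induction r with
    | zero => simp [hE]
    | succ r ih =>
      have h1 : f (x (r + 1)) - f xm ≤ q * (f (x r) - f xm) := by
        rw [hq, div_mul_eq_mul_div, le_div_iff₀ (by positivity)]
        linarith [(hone r).1]
      calc _ ≤ q * (f (x r) - f xm) := h1
        _ ≤ q * (E * q ^ r) := by gcongr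
        _ = _ := by ring
  have hE0 : 0 ≤ E := sub_nonneg.2 (hxm _)
  -- The squared step length is bounded by the decrease, so distances decay at the square root of
  -- the rate of the objective.
  set ρ := Real.sqrt q with hρ
  have hρ0 : 0 < ρ := Real.sqrt_pos.2 hq0
  have hρ1 : ρ < 1 := by rw [hρ, Real.sqrt_lt' one_pos]; simpa using hq1
  set H := Real.sqrt (K ^ 3 * E) with hH
  have hdist : ∀ r, dist (x r) (x (r + 1)) ≤ H * ρ ^ r := by
    intro r
    rw [dist_comm, dist_eq_norm]
    refine abs_le_of_sq_le_sq' ?_ (by positivity) |>.2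
    calc ‖x (r + 1) - x r‖ ^ 2 ≤ K ^ 3 * (f (x r) - f (x (r + 1))) := (hone r).2
      _ ≤ K ^ 3 * (E * q ^ r) := by
        gcongr
        linarith [hgap r, hxm (x (r + 1))]
      _ = (H * ρ ^ r) ^ 2 := by
        rw [mul_pow, ← pow_mul, mul_comm r 2, pow_mul, hH, hρ, Real.sq_sqrt (by positivity),
          Real.sq_sqrt hq0.le, mul_assoc]
  have : CompleteSpace V := FiniteDimensional.complete ℝ V
  obtain ⟨x₀, hlim⟩ := cauchySeq_tendsto_of_complete
    (cauchySeq_of_le_geometric ρ H hρ1 hdist)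
  refine ⟨x₀, fun y => ?_, H / (1 - ρ), ρ, hρ0, hρ1, fun r => ?_⟩
  · have hc : Tendsto (fun r => f (x r)) atTop (𝓝 (f x₀)) :=
      (continuous_expObj.tendsto x₀).comp hlim
    have hz : Tendsto (fun r => E * q ^ r + f xm) atTop (𝓝 (f xm)) := by
      have := ((tendsto_pow_atTop_nhds_zero_of_lt_one hq0.le hq1).const_mul E).add_const (f xm)
      simpa using this
    exact (le_of_tendsto_of_tendsto' hc hz fun r => by linarith [hgap r]).trans (hxm y)
  · rw [← dist_eq_norm]
    have := dist_le_of_le_geometric_of_tendsto ρ H hρ1 hdist hlim r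
    calc _ ≤ H * ρ ^ r / (1 - ρ) := this
      _ = _ := by ring

end ExpObjective

/-! ### Marginals of Markov chains by forward and backward messages. -/

section MessagePassing

/-- The weight of a path of a Markov chain with local weights `g` and transition weights `h`. -/
def pathWeight {X : Type*} {S : ℕ} (g : Fin (S + 1) → X → ℝ) (h : X → X → ℝ)
    (z : Fin (S + 1) → X) : ℝ :=
  (∏ t, g t (z t)) * ∏ t : Fin S, h (z t.castSucc) (z t.succ)

variable {X : Type*} {S : ℕ}

lemma pathWeight_cons (g : Fin (S + 2) → X → ℝ) (h : X → X → ℝ) (x : X) (z : Fin (S + 1) → X) :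
    pathWeight g h (Fin.cons x z : Fin (S + 2) → X) =
      g 0 x * h x (z 0) * pathWeight (fun t => g t.succ) h z := by
  unfold pathWeight
  rw [Fin.prod_univ_succ (fun t => g t ((Fin.cons x z : Fin (S + 2) → X) t)),
    Fin.prod_univ_succ (fun t : Fin (S + 1) => h ((Fin.cons x z : Fin (S + 2) → X) t.castSucc)
      ((Fin.cons x z : Fin (S + 2) → X) t.succ))]
  simp only [Fin.cons_zero, Fin.cons_succ, Fin.castSucc_zero, ← Fin.succ_castSucc]
  ring

lemma sum_fin_cons [Fintype X] (f : (Fin (S + 1) → X) → ℝ) :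
    ∑ z, f z = ∑ x, ∑ z : Fin S → X, f (Fin.cons x z : Fin (S + 1) → X) := by
  rw [← (Fin.consEquiv (fun _ : Fin (S + 1) => X)).sum_comp, Fintype.sum_prod_type]
  rfl

variable [Fintype X]

/-- An arbitrary `φ` on the initial state is needed for the induction: once the first state `x` is
split off, the rest of the chain is summed against `h x`. -/
lemma sum_pathWeight_zero (g : Fin (S + 1) → X → ℝ) (h : X → X → ℝ) (L : Fin (S + 1) → X → ℝ)
    (hlast : ∀ w, L (Fin.last S) w = 1)
    (hL : ∀ (s : Fin S) (z : X), L s.castSucc z = ∑ w, h z w * g s.succ w * L s.succ w)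
    (φ : X → ℝ) :
    ∑ z, φ (z 0) * pathWeight g h z = ∑ w, φ w * g 0 w * L 0 w := by
  induction S generalizing φ with
  | zero =>
    rw [sum_fin_cons]
    refine Finset.sum_congr rfl fun x _ => ?_
    have : L 0 x = 1 := hlast x
    simp [pathWeight, this]
  | succ S ih =>
    rw [sum_fin_cons]
    refine Finset.sum_congr rfl fun x _ => ?_
    have ih' := ih (fun t => g t.succ) (fun t => L t.succ) (fun w => hlast w)
      (fun s z => hL s.succ z) (fun w => h x w)
    have h0 : L 0 x = ∑ w, h x w * g (Fin.succ 0) w * L (Fin.succ 0) w := hL 0 x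
    rw [h0, ← ih', Finset.mul_sum]
    refine Finset.sum_congr rfl fun z _ => ?_
    rw [pathWeight_cons, Fin.cons_zero]
    ring

/-- Marginals of a Markov chain in terms of forward and backward messages. -/
lemma sum_pathWeight (g : Fin (S + 1) → X → ℝ) (h : X → X → ℝ) (R L : Fin (S + 1) → X → ℝ)
    (hlast : ∀ w, L (Fin.last S) w = 1)
    (hL : ∀ (s : Fin S) (z : X), L s.castSucc z = ∑ w, h z w * g s.succ w * L s.succ w)
    (hR : ∀ (s : Fin S) (w : X), R s.succ w = ∑ z, R s.castSucc z * g s.castSucc z * h z w)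
    (t : Fin (S + 1)) (ψ : X → ℝ) :
    ∑ z, R 0 (z 0) * ψ (z t) * pathWeight g h z = ∑ w, ψ w * (R t w * g t w * L t w) := by
  induction S with
  | zero =>
    have ht : t = 0 := Fin.ext (by lia)
    subst ht
    rw [sum_pathWeight_zero g h L hlast hL (fun w => R 0 w * ψ w)]
    exact Finset.sum_congr rfl fun w _ => by ring
  | succ S ih =>
    refine Fin.cases ?_ (fun t => ?_) t
    · rw [sum_pathWeight_zero g h L hlast hL (fun w => R 0 w * ψ w)]
      exact Finset.sum_congr rfl fun w _ => by ring
    -- Summing out the first state turns `R 0` into `R 1`, the initial message of the shortened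
    -- chain. This is why `R 0` is left arbitrary.
    · rw [← ih (fun t => g t.succ) (fun t => R t.succ) (fun t => L t.succ) (fun w => hlast w)
        (fun s z => hL s.succ z) (fun s z => hR s.succ z) t, sum_fin_cons, Finset.sum_comm]
      refine Finset.sum_congr rfl fun z _ => ?_
      have h0 : R (Fin.succ 0) (z 0) = ∑ x, R 0 x * g 0 x * h x (z 0) := hR 0 (z 0)
      rw [h0, Finset.sum_mul, Finset.sum_mul]
      refine Finset.sum_congr rfl fun x _ => ?_
      rw [pathWeight_cons, Fin.cons_zero, Fin.cons_succ]
      ring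

lemma foldl_induction {α : Type*} {N : ℕ} (f : α → Fin N → α) (P : ℕ → α → Prop) (x : α)
    (h0 : P 0 x) (hs : ∀ (i : Fin N) (y : α), P i y → P (i + 1) (f y i)) :
    P N (Fin.foldl N f x) := by
  induction N with
  | zero => simpa using h0
  | succ N ih =>
    rw [Fin.foldl_succ_last]
    exact hs (Fin.last N) _ (ih (fun y i => f y i.castSucc) fun i y hy => hs i.castSucc y hy)

lemma sum_mul_prod_eq {ι Y : Type*} [Fintype ι] [DecidableEq ι] [Fintype Y] [DecidableEq Y]
    (ν : Y → ℝ) (hν : ∑ y, ν y = 1) (t : ι) (ψ : Y → ℝ) :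
    ∑ j : ι → Y, ψ (j t) * ∏ s, ν (j s) = ∑ y, ψ y * ν y := by
  -- Absorbing `ψ` into the factor at `t` makes the sum of products a product of sums, in which all
  -- other factors equal `1`.
  have h1 : ∀ j : ι → Y, ψ (j t) * ∏ s, ν (j s) =
      ∏ s, (if s = t then ψ (j s) else 1) * ν (j s) := by
    intro j
    rw [Finset.prod_mul_distrib]
    simp
  simp_rw [h1]
  have h2 := Finset.prod_univ_sum (fun _ : ι => (Finset.univ : Finset Y))
    (fun s y => (if s = t then ψ y else 1) * ν y)
  rw [Fintype.piFinset_univ] at h2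
  rw [← h2, Finset.prod_eq_single t]
  · simp
  · intro s _ hs
    simp [hs, hν]
  · simp

end MessagePassing

/-! ### Gibbs weights and marginals. -/

section Gibbs

lemma gibbs_zero (ε : ℝ) : gibbs ε 0 = 1 := by simp [gibbs]

lemma gibbs_add (ε : ℝ) (c d : ℝ≥0∞) : gibbs ε (c + d) = gibbs ε c * gibbs ε d := by
  by_cases hc : c = ⊤
  · simp [gibbs, hc]
  by_cases hd : d = ⊤
  · simp [gibbs, hd]
  · simp only [gibbs, hc, hd, ENNReal.add_eq_top, or_self, if_false]
    rw [ENNReal.toReal_add hc hd, ← Real.exp_add]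
    ring_nf

lemma gibbs_sum {ι : Type*} (ε : ℝ) (s : Finset ι) (f : ι → ℝ≥0∞) :
    gibbs ε (∑ i ∈ s, f i) = ∏ i ∈ s, gibbs ε (f i) := by
  classical
  induction s using Finset.induction_on with
  | empty => simp [gibbs_zero]
  | insert i s hi ih => rw [Finset.sum_insert hi, Finset.prod_insert hi, gibbs_add, ih]

lemma gibbs_ofReal (ε : ℝ) {x : ℝ} (hx : 0 ≤ x) :
    gibbs ε (ENNReal.ofReal x) = Real.exp (-x / ε) := by
  simp [gibbs, ENNReal.toReal_ofReal hx]

lemma gibbs_pos (ε : ℝ) {c : ℝ≥0∞} (hc : c ≠ ⊤) : 0 < gibbs ε c := by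
  simp [gibbs, hc, Real.exp_pos]

lemma gibbs_nonneg (ε : ℝ) (c : ℝ≥0∞) : 0 ≤ gibbs ε c := by
  unfold gibbs
  split_ifs
  · exact le_rfl
  · exact (Real.exp_pos _).le

lemma rowMarginal_pos {m n : ℕ} (hn : 1 ≤ n) (i : Fin (m + 1)) : 0 < rowMarginal m n i := by
  refine Fin.lastCases ?_ (fun i => ?_) i
  · simp only [rowMarginal, Fin.snoc_last, Nat.cast_pos]; lia
  · simp [rowMarginal]

lemma colMarginal_pos {m n : ℕ} (hm : 1 ≤ m) (j : Fin (n + 1)) : 0 < colMarginal m n j := by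
  refine Fin.lastCases ?_ (fun i => ?_) j
  · simp only [colMarginal, Fin.snoc_last, Nat.cast_pos]; lia
  · simp [colMarginal]

lemma sum_rowMarginal (m n : ℕ) : ∑ i, rowMarginal m n i = m + n := by
  rw [Fin.sum_univ_castSucc]
  simp [rowMarginal]

lemma sum_colMarginal (m n : ℕ) : ∑ j, colMarginal m n j = m + n := by
  rw [Fin.sum_univ_castSucc]
  simp [colMarginal, add_comm]

end Gibbs

namespace Problem

variable {E : Type*} {m n S : ℕ}

lemma khat_pos (Q : Problem E m n S) {z w : Pos m n} (h : z.1 = w.1) : 0 < Q.khat z w := by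
  apply gibbs_pos
  simp [F, h]

lemma khat_nonneg (Q : Problem E m n S) (z w : Pos m n) : 0 ≤ Q.khat z w := gibbs_nonneg _ _

lemma khat_eq_zero (Q : Problem E m n S) {z w : Pos m n} (h : z.1 ≠ w.1) : Q.khat z w = 0 := by
  simp [khat, gibbs, F, h]

variable [NormedAddCommGroup E]

/-! ### The dual objective as a sum of exponentials over constant-row paths. -/

/-- The transport tensor is supported on paths with a constant row, which are indexed by the row
and the sequence of columns. -/
abbrev Support (m n S : ℕ) : Type := Fin (m + 1) × (Fin (S + 1) → Fin (n + 1))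

/-- The path with constant row `z.1` and columns `z.2`. -/
def supportPath (z : Support m n S) : Path m n S := fun t => (z.1, z.2 t)

lemma supportPath_injective : Function.Injective (supportPath (m := m) (n := n) (S := S)) := by
  intro z w h
  refine Prod.ext ?_ (funext fun t => ?_)
  · exact (Prod.mk.inj (congrFun h 0)).1
  · exact (Prod.mk.inj (congrFun h t)).2

/-- The linear map that sums up the dual variables along each path in the support. -/
def pathSum (m n S : ℕ) : Duals m n S →ₗ[ℝ] Support m n S → ℝ where
  toFun d z := ∑ t, d.1 t z.1 + ∑ t, d.2 t (z.2 t)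
  map_add' d e := by
    ext z
    simp only [Prod.fst_add, Prod.snd_add, Pi.add_apply, Finset.sum_add_distrib]
    ring
  map_smul' r d := by
    ext z
    simp only [Prod.smul_fst, Prod.smul_snd, Pi.smul_apply, smul_eq_mul, RingHom.id_apply,
      mul_add, Finset.mul_sum]

lemma pathSum_apply (d : Duals m n S) (z : Support m n S) :
    pathSum m n S d z = ∑ t, d.1 t z.1 + ∑ t, d.2 t (z.2 t) := rfl

/-- The Gibbs weights on the support. -/
noncomputable def supportWeight (Q : Problem E m n S) (z : Support m n S) : ℝ :=
  gibbs Q.ε (Q.C (supportPath z))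

/-- A strictly positive feasible transport plan. -/
noncomputable def feasiblePlan (m n S : ℕ) (z : Support m n S) : ℝ :=
  rowMarginal m n z.1 * ∏ t, (colMarginal m n (z.2 t) / (m + n))

lemma feasiblePlan_pos (hm : 1 ≤ m) (hn : 1 ≤ n) (z : Support m n S) :
    0 < feasiblePlan m n S z := by
  refine mul_pos (rowMarginal_pos hn _) (Finset.prod_pos fun t _ => ?_)
  have : (0 : ℝ) < m := by exact_mod_cast hm
  exact div_pos (colMarginal_pos hm _) (by positivity)

lemma sum_feasiblePlan_row (hm : 1 ≤ m) (ψ : Fin (m + 1) → ℝ) :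
    ∑ z, feasiblePlan m n S z * ψ z.1 = ∑ i, rowMarginal m n i * ψ i := by
  have h0 : ((m : ℝ) + n) ≠ 0 := by
    have : (0 : ℝ) < m := by exact_mod_cast hm
    positivity
  have hν : ∑ j, colMarginal m n j / ((m : ℝ) + n) = 1 := by
    rw [← Finset.sum_div, sum_colMarginal, div_self h0]
  rw [Fintype.sum_prod_type]
  refine Finset.sum_congr rfl fun i _ => ?_
  have h1 := sum_mul_prod_eq _ hν (0 : Fin (S + 1)) (fun _ => 1)
  simp only [one_mul, hν] at h1
  simp only [feasiblePlan]
  rw [← Finset.sum_mul, ← Finset.mul_sum, h1, mul_one]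

lemma sum_feasiblePlan_col (hm : 1 ≤ m) (t : Fin (S + 1)) (ψ : Fin (n + 1) → ℝ) :
    ∑ z, feasiblePlan m n S z * ψ (z.2 t) = ∑ j, colMarginal m n j * ψ j := by
  have h0 : ((m : ℝ) + n) ≠ 0 := by
    have : (0 : ℝ) < m := by exact_mod_cast hm
    positivity
  have hν : ∑ j, colMarginal m n j / ((m : ℝ) + n) = 1 := by
    rw [← Finset.sum_div, sum_colMarginal, div_self h0]
  have h1 := sum_mul_prod_eq _ hν t ψ
  have h2 : ∀ i : Fin (m + 1), ∑ j : Fin (S + 1) → Fin (n + 1),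
      feasiblePlan m n S (i, j) * ψ (j t) =
      rowMarginal m n i * ∑ y, ψ y * (colMarginal m n y / ((m : ℝ) + n)) := by
    intro i
    rw [← h1, Finset.mul_sum]
    refine Finset.sum_congr rfl fun j _ => ?_
    simp only [feasiblePlan]
    ring
  rw [Fintype.sum_prod_type]
  simp only [h2]
  rw [← Finset.sum_mul, sum_rowMarginal, Finset.mul_sum]
  refine Finset.sum_congr rfl fun j _ => ?_
  field_simp

/-- This expresses the linear part of the dual through `pathSum` with positive coefficients, as
coercivity of `expObj` requires. The plan has the right marginals because both marginals have the
same mass `m + n`. -/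
lemma sum_feasiblePlan_pathSum (hm : 1 ≤ m) (d : Duals m n S) :
    ∑ z, feasiblePlan m n S z * pathSum m n S d z =
      ∑ t, ∑ i, rowMarginal m n i * d.1 t i + ∑ t, ∑ j, colMarginal m n j * d.2 t j := by
  simp only [pathSum_apply, mul_add, Finset.mul_sum]
  rw [Finset.sum_add_distrib, Finset.sum_comm,
    Finset.sum_comm (s := Finset.univ (α := Support m n S))]
  congr 1
  · exact Finset.sum_congr rfl fun t _ => sum_feasiblePlan_row hm _
  · exact Finset.sum_congr rfl fun t _ => sum_feasiblePlan_col hm t _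

lemma baseDist_nonneg (Q : Problem E m n S) (hc : 0 < Q.c) (x y : Option E) :
    0 ≤ Q.baseDist x y := by
  rcases x with _ | x <;> rcases y with _ | y <;> simp only [baseDist]
  · exact le_rfl
  · positivity
  · positivity
  · exact le_min (norm_nonneg _) hc.le

lemma gibbs_C (Q : Problem E m n S) (hc : 0 < Q.c) (z : Path m n S) :
    gibbs Q.ε (Q.C z) = (∏ t, Q.k t (z t)) * ∏ t : Fin S, Q.khat (z t.castSucc) (z t.succ) := by
  rw [C, gibbs_add, gibbs_sum, gibbs_sum]
  congr 1
  refine Finset.prod_congr rfl fun t _ => ?_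
  rw [D, gibbs_ofReal _ (Real.rpow_nonneg (Q.baseDist_nonneg hc _ _) _)]
  rfl

lemma k_pos (Q : Problem E m n S) (t : Fin (S + 1)) (z : Pos m n) : 0 < Q.k t z := Real.exp_pos _

lemma supportWeight_pos (Q : Problem E m n S) (hc : 0 < Q.c) (z : Support m n S) :
    0 < Q.supportWeight z := by
  rw [supportWeight, gibbs_C Q hc]
  exact mul_pos (Finset.prod_pos fun t _ => Q.k_pos _ _)
    (Finset.prod_pos fun t _ => Q.khat_pos rfl)

/-- A path off the support changes its row somewhere, and that transition has infinite cost. -/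
lemma gibbs_C_eq_zero (Q : Problem E m n S) (hc : 0 < Q.c) {z : Path m n S}
    (hz : z ∉ Set.range (supportPath (m := m) (n := n) (S := S))) : gibbs Q.ε (Q.C z) = 0 := by
  by_contra hne
  apply hz
  have hstep : ∀ t : Fin S, (z t.castSucc).1 = (z t.succ).1 := by
    intro t
    by_contra h
    apply hne
    rw [gibbs_C Q hc, Finset.prod_eq_zero (Finset.mem_univ t) (Q.khat_eq_zero h), mul_zero]
  have hconst : ∀ t, (z t).1 = (z 0).1 := by
    intro t
    induction t using Fin.induction with
    | zero => rfl
    | succ t ih => rw [← hstep t, ih]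
  exact ⟨((z 0).1, fun t => (z t).2), funext fun t => Prod.ext (hconst t).symm rfl⟩

lemma sum_support (Q : Problem E m n S) (hc : 0 < Q.c) (G : Path m n S → ℝ) :
    ∑ z, gibbs Q.ε (Q.C z) * G z = ∑ z, Q.supportWeight z * G (supportPath z) := by
  symm
  refine Fintype.sum_of_injective _ supportPath_injective _ _ (fun z hz => ?_) fun z => rfl
  rw [Q.gibbs_C_eq_zero hc hz, zero_mul]

/-- The dual objective is, up to scaling and a constant, a sum of exponentials plus a linear
function. -/
lemma dualObj_eq (Q : Problem E m n S) (hm : 1 ≤ m) (hc : 0 < Q.c) (hε : 0 < Q.ε)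
    (x : Duals m n S) :
    Q.dualObj (Q.ε • x) =
      -Q.ε * expObj (pathSum m n S) Q.supportWeight (feasiblePlan m n S) x +
        Q.ε * ((m : ℝ) + 1) ^ (S + 1) * ((n : ℝ) + 1) ^ (S + 1) := by
  have h1 : ∀ z : Path m n S, gibbs Q.ε (Q.C z) *
      (∏ t, Real.exp ((Q.ε • x).1 t (z t).1 / Q.ε)) *
        (∏ t, Real.exp ((Q.ε • x).2 t (z t).2 / Q.ε)) =
      gibbs Q.ε (Q.C z) * Real.exp (∑ t, x.1 t (z t).1 + ∑ t, x.2 t (z t).2) := by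
    intro z
    rw [mul_assoc, ← Real.exp_sum, ← Real.exp_sum, ← Real.exp_add]
    simp only [Prod.smul_fst, Prod.smul_snd, Pi.smul_apply, smul_eq_mul,
      mul_div_cancel_left₀ _ hε.ne']
  have h2 : ∑ t, ∑ i, rowMarginal m n i * (Q.ε • x).1 t i =
      Q.ε * ∑ t, ∑ i, rowMarginal m n i * x.1 t i := by
    simp only [Finset.mul_sum, Prod.smul_fst, Pi.smul_apply, smul_eq_mul, mul_left_comm]
  have h3 : ∑ t, ∑ i, colMarginal m n i * (Q.ε • x).2 t i =
      Q.ε * ∑ t, ∑ i, colMarginal m n i * x.2 t i := by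
    simp only [Finset.mul_sum, Prod.smul_snd, Pi.smul_apply, smul_eq_mul, mul_left_comm]
  have h4 := sum_feasiblePlan_pathSum hm x
  rw [dualObj, h2, h3]
  simp only [h1]
  rw [Q.sum_support hc]
  simp only [expObj, Finset.sum_sub_distrib, h4]
  have h5 : ∀ z : Support m n S, ∑ t, x.1 t (supportPath z t).1 + ∑ t, x.2 t (supportPath z t).2 =
    pathSum m n S x z := fun z => rfl
  simp only [h5]
  ring

/-! ### Blocks of dual variables -/

/-- The subspace of the row variables at time `t`. -/
def rowBlock (m n : ℕ) (t : Fin (S + 1)) : Submodule ℝ (Duals m n S) where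
  carrier := {d | (∀ s, s ≠ t → d.1 s = 0) ∧ d.2 = 0}
  add_mem' := by
    rintro d e ⟨h1, h2⟩ ⟨h3, h4⟩
    exact ⟨fun s hs => by simp [h1 s hs, h3 s hs], by simp [h2, h4]⟩
  zero_mem' := ⟨fun _ _ => rfl, rfl⟩
  smul_mem' := by
    rintro r d ⟨h1, h2⟩
    exact ⟨fun s hs => by simp [h1 s hs], by simp [h2]⟩

/-- The subspace of the column variables at time `t`. -/
def colBlock (m n : ℕ) (t : Fin (S + 1)) : Submodule ℝ (Duals m n S) where
  carrier := {d | d.1 = 0 ∧ ∀ s, s ≠ t → d.2 s = 0}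
  add_mem' := by
    rintro d e ⟨h2, h1⟩ ⟨h4, h3⟩
    exact ⟨by simp [h2, h4], fun s hs => by simp [h1 s hs, h3 s hs]⟩
  zero_mem' := ⟨rfl, fun _ _ => rfl⟩
  smul_mem' := by
    rintro r d ⟨h2, h1⟩
    exact ⟨by simp [h2], fun s hs => by simp [h1 s hs]⟩

/-- All blocks of dual variables. -/
def block (m n S : ℕ) : Fin (S + 1) ⊕ Fin (S + 1) → Submodule ℝ (Duals m n S) :=
  Sum.elim (rowBlock m n) (colBlock m n)

lemma pathSum_rowBlock {t : Fin (S + 1)} {d : Duals m n S} (hd : d ∈ rowBlock m n t)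
    (z : Support m n S) : pathSum m n S d z = d.1 t z.1 := by
  rw [pathSum_apply, Finset.sum_eq_single t (fun s _ hs => by rw [hd.1 s hs]; rfl) (by simp)]
  simp [hd.2]

lemma pathSum_colBlock {t : Fin (S + 1)} {d : Duals m n S} (hd : d ∈ colBlock m n t)
    (z : Support m n S) : pathSum m n S d z = d.2 t (z.2 t) := by
  rw [pathSum_apply, Finset.sum_eq_single (f := fun s => d.2 s (z.2 s)) t
    (fun s _ hs => by rw [hd.2 s hs]; rfl) (by simp)]
  simp [hd.1]

/-- On a single block, evaluating `pathSum` at a path through a given row or column returns exactly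
that entry, hence the constant `1`. -/
lemma norm_le_of_mem_block (i : Fin (S + 1) ⊕ Fin (S + 1)) (d : Duals m n S)
    (hd : d ∈ block m n S i) : ‖d‖ ≤ 1 * ‖pathSum m n S d‖ := by
  rw [one_mul]
  have h0 : 0 ≤ ‖pathSum m n S d‖ := norm_nonneg _
  rcases i with t | t
  · change d ∈ rowBlock m n t at hd
    rw [Prod.norm_def, hd.2, norm_zero]
    refine max_le ?_ h0
    refine (pi_norm_le_iff_of_nonneg h0).2 fun s => (pi_norm_le_iff_of_nonneg h0).2 fun i => ?_
    by_cases hs : s = t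
    · subst hs
      have := norm_le_pi_norm (pathSum m n S d) (i, fun _ => 0)
      rwa [pathSum_rowBlock hd] at this
    · rw [hd.1 s hs]; simp
  · change d ∈ colBlock m n t at hd
    rw [Prod.norm_def, hd.1, norm_zero]
    refine max_le h0 ?_
    refine (pi_norm_le_iff_of_nonneg h0).2 fun s => (pi_norm_le_iff_of_nonneg h0).2 fun j => ?_
    by_cases hs : s = t
    · subst hs
      have := norm_le_pi_norm (pathSum m n S d) (0, fun _ => j)
      rwa [pathSum_colBlock hd] at this
    · rw [hd.2 s hs]; simp

lemma norm_single_le {ι : Type*} [Fintype ι] [DecidableEq ι] {G : Type*} [NormedAddCommGroup G]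
    (f : ι → G) (t : ι) : ‖(Pi.single t (f t) : ι → G)‖ ≤ ‖f‖ := by
  refine (pi_norm_le_iff_of_nonneg (norm_nonneg _)).2 fun s => ?_
  by_cases hs : s = t
  · subst hs; simpa using norm_le_pi_norm f s
  · simp [hs]

lemma exists_block_decomposition (d : Duals m n S) :
    ∃ e : Fin (S + 1) ⊕ Fin (S + 1) → Duals m n S,
      (∀ i, e i ∈ block m n S i) ∧ ∑ i, e i = d ∧ ∀ i, ‖e i‖ ≤ ‖d‖ := by
  refine ⟨Sum.elim (fun t => (Pi.single t (d.1 t), 0)) (fun t => (0, Pi.single t (d.2 t))),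
    ?_, ?_, ?_⟩
  · rintro (t | t)
    · exact ⟨fun s hs => by simp [hs], rfl⟩
    · exact ⟨rfl, fun s hs => by simp [hs]⟩
  · rw [Fintype.sum_sum_type]
    refine Prod.ext ?_ ?_
    · simp [Prod.fst_sum, Finset.univ_sum_single]
    · simp [Prod.snd_sum, Finset.univ_sum_single]
  · rintro (t | t)
    · simp only [Sum.elim_inl, Prod.norm_def, norm_zero]
      exact max_le ((norm_single_le d.1 t).trans (le_max_left _ _))
        ((norm_nonneg d.1).trans (le_max_left _ _))
    · simp only [Sum.elim_inr, Prod.norm_def, norm_zero]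
      exact max_le ((norm_nonneg d.1).trans (le_max_left _ _))
        ((norm_single_le d.2 t).trans (le_max_right _ _))

/-! ### Messages as functions of the variables. -/

/-- All variables are positive. -/
def AllPos (u : Duals m n S) : Prop := ∀ t, (∀ i, 0 < u.1 t i) ∧ ∀ j, 0 < u.2 t j

/-- The variables at the times satisfying `p` coincide. -/
def AgreeOn (p : Fin (S + 1) → Prop) (u v : Duals m n S) : Prop :=
  ∀ t, p t → u.1 t = v.1 t ∧ u.2 t = v.2 t

/-- The weight at time `t` of a path through `w`. -/
noncomputable def localWeight (Q : Problem E m n S) (u : Duals m n S) (t : Fin (S + 1))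
    (w : Pos m n) : ℝ :=
  Q.k t w * u.1 t w.1 * u.2 t w.2

lemma localWeight_pos (Q : Problem E m n S) {u : Duals m n S} (hu : AllPos u) (t : Fin (S + 1))
    (w : Pos m n) : 0 < Q.localWeight u t w :=
  mul_pos (mul_pos (Q.k_pos _ _) ((hu t).1 _)) ((hu t).2 _)

lemma localWeight_congr (Q : Problem E m n S) {u v : Duals m n S} {t : Fin (S + 1)}
    (h : u.1 t = v.1 t ∧ u.2 t = v.2 t) : Q.localWeight u t = Q.localWeight v t := by
  funext w
  simp [localWeight, h.1, h.2]

lemma backward_last (Q : Problem E m n S) (u : Duals m n S) (z : Pos m n) :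
    Q.backward u (Fin.last S) z = 1 := by
  simp [backward]

lemma backward_castSucc (Q : Problem E m n S) (u : Duals m n S) (s : Fin S) (z : Pos m n) :
    Q.backward u s.castSucc z =
      ∑ w, Q.khat z w * Q.localWeight u s.succ w * Q.backward u s.succ w := by
  unfold backward
  rw [Fin.reverseInduction_castSucc]
  refine Finset.sum_congr rfl fun w _ => ?_
  simp only [localWeight]
  ring

/-- The strict inequality matters: the message at `t` ignores the variables at `t`, so updating them
does not invalidate it. -/
lemma backward_congr (Q : Problem E m n S) {u v : Duals m n S} (t : Fin (S + 1))
    (h : AgreeOn (t < ·) u v) : Q.backward u t = Q.backward v t := by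
  induction t using Fin.reverseInduction with
  | last => funext z; rw [backward_last, backward_last]
  | cast s ih =>
    have h1 : Q.backward u s.succ = Q.backward v s.succ :=
      ih fun t ht => h t (lt_trans (Fin.castSucc_lt_succ (i := s)) ht)
    funext z
    rw [backward_castSucc, backward_castSucc, h1,
      Q.localWeight_congr (h s.succ (Fin.castSucc_lt_succ (i := s)))]

lemma backward_pos (Q : Problem E m n S) {u : Duals m n S} (hu : AllPos u) (t : Fin (S + 1)) :
    ∀ z, 0 < Q.backward u t z := by
  induction t using Fin.reverseInduction with
  | last => intro z; rw [backward_last]; exact one_pos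
  | cast s ih =>
    intro z
    rw [backward_castSucc]
    -- Staying at `z` keeps the row and so has positive `khat`; the other transitions may have
    -- weight zero.
    refine Finset.sum_pos' (fun w _ => ?_) ⟨z, Finset.mem_univ z, ?_⟩
    · exact mul_nonneg (mul_nonneg (Q.khat_nonneg _ _) (Q.localWeight_pos hu _ _).le) (ih w).le
    · exact mul_pos (mul_pos (Q.khat_pos rfl) (Q.localWeight_pos hu _ _)) (ih z)

/-- The forward messages. -/
noncomputable def forward (Q : Problem E m n S) (u : Duals m n S) (t : Fin (S + 1)) :
    Pos m n → ℝ :=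
  Fin.induction (motive := fun _ => Pos m n → ℝ) (fun _ => 1)
    (fun s R => Q.forwardStep R s.castSucc u) t

lemma forward_zero (Q : Problem E m n S) (u : Duals m n S) : Q.forward u 0 = fun _ => 1 := rfl

lemma forward_succ (Q : Problem E m n S) (u : Duals m n S) (s : Fin S) :
    Q.forward u s.succ = Q.forwardStep (Q.forward u s.castSucc) s.castSucc u := by
  simp [forward]

lemma forwardStep_apply (Q : Problem E m n S) (R : Pos m n → ℝ) (t : Fin (S + 1))
    (u : Duals m n S) (w : Pos m n) :
    Q.forwardStep R t u w = ∑ z, R z * Q.localWeight u t z * Q.khat z w := by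
  refine Finset.sum_congr rfl fun z _ => ?_
  simp only [localWeight]
  ring

lemma forward_congr (Q : Problem E m n S) {u v : Duals m n S} (t : Fin (S + 1))
    (h : AgreeOn (· < t) u v) : Q.forward u t = Q.forward v t := by
  induction t using Fin.induction with
  | zero => rfl
  | succ s ih =>
    have h1 := ih fun t ht => h t (lt_trans ht (Fin.castSucc_lt_succ (i := s)))
    funext z
    rw [forward_succ, forward_succ, forwardStep_apply, forwardStep_apply, h1,
      Q.localWeight_congr (h s.castSucc (Fin.castSucc_lt_succ (i := s)))]

lemma forward_pos (Q : Problem E m n S) {u : Duals m n S} (hu : AllPos u) (t : Fin (S + 1)) :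
    ∀ z, 0 < Q.forward u t z := by
  induction t using Fin.induction with
  | zero => intro z; rw [forward_zero]; exact one_pos
  | succ s ih =>
    intro w
    rw [forward_succ, forwardStep_apply]
    refine Finset.sum_pos' (fun z _ => ?_) ⟨w, Finset.mem_univ w, ?_⟩
    · exact mul_nonneg (mul_nonneg (ih z).le (Q.localWeight_pos hu _ _).le) (Q.khat_nonneg _ _)
    · exact mul_pos (mul_pos (ih w) (Q.localWeight_pos hu _ _)) (Q.khat_pos rfl)

/-- The logarithms of the transformed variables. -/
noncomputable def logDual (u : Duals m n S) : Duals m n S :=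
  (fun t i => Real.log (u.1 t i), fun t j => Real.log (u.2 t j))

lemma gibbs_mul_prod (Q : Problem E m n S) (hc : 0 < Q.c) (u : Duals m n S) (z : Path m n S) :
    gibbs Q.ε (Q.C z) * ((∏ t, u.1 t (z t).1) * ∏ t, u.2 t (z t).2) =
      pathWeight (Q.localWeight u) Q.khat z := by
  rw [Q.gibbs_C hc, pathWeight]
  simp only [localWeight, Finset.prod_mul_distrib]
  ring

lemma exp_pathSum_logDual {u : Duals m n S} (hu : AllPos u) (z : Support m n S) :
    Real.exp (pathSum m n S (logDual u) z) =
      (∏ t, u.1 t (supportPath z t).1) * ∏ t, u.2 t (supportPath z t).2 := by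
  rw [pathSum_apply, Real.exp_add, Real.exp_sum, Real.exp_sum]
  congr 1
  · exact Finset.prod_congr rfl fun t _ => Real.exp_log ((hu t).1 _)
  · exact Finset.prod_congr rfl fun t _ => Real.exp_log ((hu t).2 _)

/-- The messages compute the marginals of the transport tensor. -/
lemma sum_proj (Q : Problem E m n S) (hc : 0 < Q.c) {u : Duals m n S} (hu : AllPos u)
    (t : Fin (S + 1)) (ψ : Pos m n → ℝ) :
    ∑ z, Q.supportWeight z * Real.exp (pathSum m n S (logDual u) z) * ψ (supportPath z t) =
      ∑ w, ψ w * Q.proj (Q.forward u t) (Q.backward u t) u t w := by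
  have h1 := sum_pathWeight (Q.localWeight u) Q.khat (Q.forward u) (Q.backward u)
    (Q.backward_last u) (Q.backward_castSucc u)
    (fun s w => by rw [forward_succ, forwardStep_apply]) t ψ
  have h2 := Q.sum_support hc
    (fun z => ((∏ t, u.1 t (z t).1) * ∏ t, u.2 t (z t).2) * ψ (z t))
  calc _ = ∑ z, Q.forward u 0 (z 0) * ψ (z t) * pathWeight (Q.localWeight u) Q.khat z := by
        simp only [exp_pathSum_logDual hu, mul_assoc] at h2 ⊢
        rw [← h2]
        refine Finset.sum_congr rfl fun z _ => ?_
        rw [← Q.gibbs_mul_prod hc, forward_zero]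
        ring
    _ = _ := by
        rw [h1]
        refine Finset.sum_congr rfl fun w _ => ?_
        simp only [proj, localWeight]
        ring

/-- The derivative of the objective along the row variables at time `t`. -/
lemma expGrad_rowBlock (Q : Problem E m n S) (hm : 1 ≤ m) (hc : 0 < Q.c) {u : Duals m n S}
    (hu : AllPos u) {t : Fin (S + 1)} {d : Duals m n S} (hd : d ∈ rowBlock m n t) :
    expGrad (pathSum m n S) Q.supportWeight (feasiblePlan m n S) (logDual u) d =
      ∑ i, d.1 t i * (∑ j, Q.proj (Q.forward u t) (Q.backward u t) u t (i, j) -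
        rowMarginal m n i) := by
  have h1 := Q.sum_proj hc hu t (fun w => d.1 t w.1)
  have h2 := sum_feasiblePlan_row (n := n) (S := S) hm (d.1 t)
  simp only [expGrad_apply, pathSum_rowBlock hd, sub_mul, mul_sub, Finset.sum_sub_distrib, h2]
  congr 1
  · refine h1.trans ?_
    rw [Fintype.sum_prod_type]
    exact Finset.sum_congr rfl fun i _ => by rw [Finset.mul_sum]
  · exact Finset.sum_congr rfl fun i _ => mul_comm _ _

/-- The derivative of the objective along the column variables at time `t`. -/
lemma expGrad_colBlock (Q : Problem E m n S) (hm : 1 ≤ m) (hc : 0 < Q.c) {u : Duals m n S}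
    (hu : AllPos u) {t : Fin (S + 1)} {d : Duals m n S} (hd : d ∈ colBlock m n t) :
    expGrad (pathSum m n S) Q.supportWeight (feasiblePlan m n S) (logDual u) d =
      ∑ j, d.2 t j * (∑ i, Q.proj (Q.forward u t) (Q.backward u t) u t (i, j) -
        colMarginal m n j) := by
  have h1 := Q.sum_proj hc hu t (fun w => d.2 t w.2)
  have h2 := sum_feasiblePlan_col (n := n) (S := S) hm t (d.2 t)
  simp only [expGrad_apply, pathSum_colBlock hd, sub_mul, mul_sub, Finset.sum_sub_distrib, h2]
  congr 1
  · refine h1.trans ?_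
    rw [Fintype.sum_prod_type_right]
    exact Finset.sum_congr rfl fun i _ => by rw [Finset.mul_sum]
  · exact Finset.sum_congr rfl fun i _ => mul_comm _ _

lemma proj_pos (Q : Problem E m n S) {u : Duals m n S} (hu : AllPos u) (t : Fin (S + 1))
    (w : Pos m n) : 0 < Q.proj (Q.forward u t) (Q.backward u t) u t w :=
  mul_pos (mul_pos (mul_pos (mul_pos (Q.forward_pos hu t w) (Q.k_pos _ _)) ((hu t).1 _))
    ((hu t).2 _)) (Q.backward_pos hu t w)

/-! ### The updates as exact block minimizations. -/

/-- `v` arises from `u` by an exact block minimization. -/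
abbrev IsStep (Q : Problem E m n S) (b : Fin (S + 1) ⊕ Fin (S + 1)) (u v : Duals m n S) : Prop :=
  IsBlockStep (pathSum m n S) Q.supportWeight (feasiblePlan m n S) (block m n S b)
    (logDual u) (logDual v)

/-- The update leaves both messages at `t` unchanged, so row `i` of the projection is multiplied by
exactly the factor that makes its sum the prescribed marginal. The gradient along the block is the
marginal defect, which becomes zero. -/
lemma updateRow_step (Q : Problem E m n S) (hm : 1 ≤ m) (hn : 1 ≤ n) (hc : 0 < Q.c)
    {u v : Duals m n S} (hu : AllPos u) (t : Fin (S + 1))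
    (hv : v = Q.updateRow (Q.forward u t) (Q.backward u t) t u) :
    AllPos v ∧ AgreeOn (· ≠ t) v u ∧ Q.IsStep (Sum.inl t) u v := by
  have hsum : ∀ i, 0 < ∑ j, Q.proj (Q.forward u t) (Q.backward u t) u t (i, j) := fun i =>
    Finset.sum_pos (fun j _ => Q.proj_pos hu t _) Finset.univ_nonempty
  have hagree : AgreeOn (· ≠ t) v u := by
    intro s hs
    subst hv
    exact ⟨by simp [updateRow, hs], rfl⟩
  have ht : ∀ i, v.1 t i =
      rowMarginal m n i / (∑ j, Q.proj (Q.forward u t) (Q.backward u t) u t (i, j)) * u.1 t i := by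
    intro i
    subst hv
    simp [updateRow]
  have h2 : v.2 = u.2 := by subst hv; rfl
  have hpos : AllPos v := by
    intro s
    refine ⟨fun i => ?_, fun j => by rw [h2]; exact (hu s).2 j⟩
    by_cases hs : s = t
    · subst hs
      rw [ht]
      exact mul_pos (div_pos (rowMarginal_pos hn i) (hsum i)) ((hu s).1 i)
    · rw [(hagree s hs).1]
      exact (hu s).1 i
  refine ⟨hpos, hagree, ⟨fun s hs => ?_, ?_⟩, fun d hd => ?_⟩
  · funext i
    simp [logDual, (hagree s hs).1]
  · funext s j
    simp [logDual, h2]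
  · rw [Q.expGrad_rowBlock hm hc hpos hd]
    refine Finset.sum_eq_zero fun i _ => ?_
    have hf := Q.forward_congr t (u := v) (v := u) fun s hs => hagree s (ne_of_lt hs)
    have hb := Q.backward_congr t (u := v) (v := u) fun s hs => hagree s (ne_of_gt hs)
    have h3 : ∀ j, Q.proj (Q.forward v t) (Q.backward v t) v t (i, j) =
        rowMarginal m n i / (∑ j, Q.proj (Q.forward u t) (Q.backward u t) u t (i, j)) *
          Q.proj (Q.forward u t) (Q.backward u t) u t (i, j) := by
      intro j
      rw [hf, hb]
      simp only [proj, ht, h2]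
      ring
    simp only [h3]
    rw [← Finset.mul_sum, div_mul_cancel₀ _ (hsum i).ne', sub_self, mul_zero]

lemma updateCol_step (Q : Problem E m n S) (hm : 1 ≤ m) (hc : 0 < Q.c)
    {u v : Duals m n S} (hu : AllPos u) (t : Fin (S + 1))
    (hv : v = Q.updateCol (Q.forward u t) (Q.backward u t) t u) :
    AllPos v ∧ AgreeOn (· ≠ t) v u ∧ Q.IsStep (Sum.inr t) u v := by
  have hsum : ∀ j, 0 < ∑ i, Q.proj (Q.forward u t) (Q.backward u t) u t (i, j) := fun i =>
    Finset.sum_pos (fun j _ => Q.proj_pos hu t _) Finset.univ_nonempty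
  have hagree : AgreeOn (· ≠ t) v u := by
    intro s hs
    subst hv
    exact ⟨rfl, by simp [updateCol, hs]⟩
  have ht : ∀ j, v.2 t j =
      colMarginal m n j / (∑ i, Q.proj (Q.forward u t) (Q.backward u t) u t (i, j)) * u.2 t j := by
    intro i
    subst hv
    simp [updateCol]
  have h2 : v.1 = u.1 := by subst hv; rfl
  have hpos : AllPos v := by
    intro s
    refine ⟨fun j => by rw [h2]; exact (hu s).1 j, fun i => ?_⟩
    by_cases hs : s = t
    · subst hs
      rw [ht]
      exact mul_pos (div_pos (colMarginal_pos hm i) (hsum i)) ((hu s).2 i)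
    · rw [(hagree s hs).2]
      exact (hu s).2 i
  refine ⟨hpos, hagree, ⟨?_, fun s hs => ?_⟩, fun d hd => ?_⟩
  · funext s j
    simp [logDual, h2]
  · funext i
    simp [logDual, (hagree s hs).2]
  · rw [Q.expGrad_colBlock hm hc hpos hd]
    refine Finset.sum_eq_zero fun j _ => ?_
    have hf := Q.forward_congr t (u := v) (v := u) fun s hs => hagree s (ne_of_lt hs)
    have hb := Q.backward_congr t (u := v) (v := u) fun s hs => hagree s (ne_of_gt hs)
    have h3 : ∀ i, Q.proj (Q.forward v t) (Q.backward v t) v t (i, j) =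
        colMarginal m n j / (∑ i, Q.proj (Q.forward u t) (Q.backward u t) u t (i, j)) *
          Q.proj (Q.forward u t) (Q.backward u t) u t (i, j) := by
      intro i
      rw [hf, hb]
      simp only [proj, ht, h2]
      ring
    simp only [h3]
    rw [← Finset.mul_sum, div_mul_cancel₀ _ (hsum j).ne', sub_self, mul_zero]

lemma updateAt_step (Q : Problem E m n S) (hm : 1 ≤ m) (hn : 1 ≤ n) (hc : 0 < Q.c)
    {u : Duals m n S} (hu : AllPos u) (t : Fin (S + 1)) :
    AllPos (Q.updateAt (Q.forward u t) (Q.backward u t) t u) ∧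
      AgreeOn (· ≠ t) (Q.updateAt (Q.forward u t) (Q.backward u t) t u) u ∧
      ∃ v, Q.IsStep (Sum.inl t) u v ∧
        Q.IsStep (Sum.inr t) v (Q.updateAt (Q.forward u t) (Q.backward u t) t u) := by
  obtain ⟨hv, hagree, hstep⟩ := Q.updateRow_step hm hn hc hu t rfl
  set v := Q.updateRow (Q.forward u t) (Q.backward u t) t u with hvdef
  have hf := Q.forward_congr t (u := v) (v := u) fun s hs => hagree s (ne_of_lt hs)
  have hb := Q.backward_congr t (u := v) (v := u) fun s hs => hagree s (ne_of_gt hs)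
  -- The column update reuses the messages of `u`; they coincide with those of the intermediate `v`,
  -- which differs only at time `t`.
  have e : Q.updateAt (Q.forward u t) (Q.backward u t) t u =
      Q.updateCol (Q.forward v t) (Q.backward v t) t v := by
    rw [hf, hb]; rfl
  rw [e]
  obtain ⟨hw, hagree', hstep'⟩ := Q.updateCol_step hm hc hv t rfl
  exact ⟨hw, fun s hs => ⟨(hagree' s hs).1.trans (hagree s hs).1,
    (hagree' s hs).2.trans (hagree s hs).2⟩, v, hstep, hstep'⟩

/-- The loop invariant: after `s` time steps starting from `u`, the variables `v` are positive,
they coincide with `u` from time `s` on, and they arise from `u` by exact minimization along all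
blocks before time `s`. -/
def LoopInvariant (Q : Problem E m n S) (u : Duals m n S) (s : ℕ) (v : Duals m n S) : Prop :=
  AllPos v ∧ AgreeOn (fun t => s ≤ t) v u ∧
    ∃ V : Set (Fin (S + 1) ⊕ Fin (S + 1)),
      (∀ t : Fin (S + 1), (t : ℕ) < s → Sum.inl t ∈ V ∧ Sum.inr t ∈ V) ∧
      BlockPath (pathSum m n S) Q.supportWeight (feasiblePlan m n S) (block m n S) (2 * s) V
        (logDual u) (logDual v)

/-- The backward message computed from `u` at the start of the sweep is still that of `v`, since
later times are untouched. Agreement before `t` is recorded so that the forward recursion can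
continue. -/
lemma LoopInvariant.updateAt {Q : Problem E m n S} (hm : 1 ≤ m) (hn : 1 ≤ n) (hc : 0 < Q.c)
    {u v : Duals m n S} {t : Fin (S + 1)} (h : Q.LoopInvariant u t v) :
    Q.LoopInvariant u (t + 1) (Q.updateAt (Q.forward v t) (Q.backward u t) t v) ∧
      AgreeOn (· < t) (Q.updateAt (Q.forward v t) (Q.backward u t) t v) v := by
  obtain ⟨hv, hagree, V, hV, hpath⟩ := h
  have hb : Q.backward u t = Q.backward v t :=
    (Q.backward_congr t fun s hs => hagree s (Fin.le_def.1 hs.le)).symm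
  rw [hb]
  obtain ⟨hw, hag, w, h1, h2⟩ := Q.updateAt_step hm hn hc hv t
  refine ⟨⟨hw, fun s hs => ?_, insert (Sum.inr t) (insert (Sum.inl t) V), fun s hs => ?_, ?_⟩,
    fun s hs => hag s (ne_of_lt hs)⟩
  · have hs' : (t : ℕ) < s := hs
    have h3 := hag s (by rintro rfl; exact lt_irrefl _ hs')
    have h4 := hagree s hs'.le
    exact ⟨h3.1.trans h4.1, h3.2.trans h4.2⟩
  · rcases Nat.lt_succ_iff_lt_or_eq.1 hs with h | h
    · exact ⟨by simp [(hV s h).1], by simp [(hV s h).2]⟩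
    · have : s = t := Fin.ext h
      subst this
      simp
  · exact (hpath.step _ h1).step _ h2

lemma sweep_invariant (Q : Problem E m n S) (hm : 1 ≤ m) (hn : 1 ≤ n) (hc : 0 < Q.c)
    {u : Duals m n S} (hu : AllPos u) : Q.LoopInvariant u (S + 1) (Q.sweep u) := by
  -- The carried message is required to be the forward message of the current variables. The loop
  -- counter is a natural number, hence the quantification over `t` with that value.
  have hloop := foldl_induction (Q.loopBody (Q.backward u))
    (fun s st => Q.LoopInvariant u s st.1 ∧
      ∀ t : Fin (S + 1), (t : ℕ) = s → st.2 = Q.forward st.1 t) (u, fun _ => 1) ?_ ?_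
  · obtain ⟨h1, h2⟩ := hloop
    -- The loop covers `S` of the `S + 1` time steps; the last one is updated after it.
    have h3 := (LoopInvariant.updateAt hm hn hc (t := Fin.last S) h1).1
    unfold sweep
    simp only
    rw [h2 (Fin.last S) rfl]
    exact h3
  · refine ⟨⟨hu, fun t _ => ⟨rfl, rfl⟩, ∅, fun t ht => absurd ht (Nat.not_lt_zero _),
      BlockPath.refl _⟩, fun t ht => ?_⟩
    have : t = 0 := Fin.ext ht
    subst this
    rfl
  · rintro i ⟨v, R⟩ ⟨h1, h2⟩
    have hR : R = Q.forward v i.castSucc := h2 i.castSucc rfl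
    subst hR
    obtain ⟨h3, h4⟩ := LoopInvariant.updateAt hm hn hc (t := i.castSucc) h1
    refine ⟨h3, fun t ht => ?_⟩
    have : t = i.succ := Fin.ext ht
    subst this
    simp only [loopBody]
    rw [forward_succ, Q.forward_congr i.castSucc h4]

lemma iter_succ (Q : Problem E m n S) (r : ℕ) : Q.iter (r + 1) = Q.sweep (Q.iter r) := by
  rw [iter, Function.iterate_succ_apply', iter]

lemma iter_pos (Q : Problem E m n S) (hm : 1 ≤ m) (hn : 1 ≤ n) (hc : 0 < Q.c) (r : ℕ) :
    AllPos (Q.iter r) := by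
  induction r with
  | zero => exact fun t => ⟨fun _ => one_pos, fun _ => one_pos⟩
  | succ r ih => rw [iter_succ]; exact (Q.sweep_invariant hm hn hc ih).1

lemma blockPath_iter (Q : Problem E m n S) (hm : 1 ≤ m) (hn : 1 ≤ n) (hc : 0 < Q.c) (r : ℕ) :
    BlockPath (pathSum m n S) Q.supportWeight (feasiblePlan m n S) (block m n S) (2 * (S + 1))
      Set.univ (logDual (Q.iter r)) (logDual (Q.iter (r + 1))) := by
  obtain ⟨-, -, V, hV, hpath⟩ := Q.sweep_invariant hm hn hc (Q.iter_pos hm hn hc r)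
  have : V = Set.univ := by
    refine Set.eq_univ_of_forall ?_
    rintro (t | t)
    · exact (hV t t.isLt).1
    · exact (hV t t.isLt).2
  rw [iter_succ, ← this]
  exact hpath

end Problem

lemma ConvergesLinearly.const_smul {V : Type*} [NormedAddCommGroup V] [NormedSpace ℝ V]
    {x : ℕ → V} {a : V} (h : ConvergesLinearly x a) (c : ℝ) :
    ConvergesLinearly (fun r => c • x r) (c • a) := by
  obtain ⟨K, ρ, h0, h1, hK⟩ := h
  refine ⟨|c| * K, ρ, h0, h1, fun r => ?_⟩
  rw [← smul_sub, norm_smul, Real.norm_eq_abs, mul_assoc]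
  exact mul_le_mul_of_nonneg_left (hK r) (abs_nonneg c)

end TGOSPA

theorem theorem3 {E : Type*} [NormedAddCommGroup E] [NormedSpace ℝ E] {m n S : ℕ}
    (hm : 1 ≤ m) (hn : 1 ≤ n) (Q : TGOSPA.Problem E m n S)
    (hp : 1 ≤ Q.p) (hγ : 0 < Q.γ) (hc : 0 < Q.c) (hε : 0 < Q.ε) :
    (∀ r t, (∀ i, 0 < (Q.iter r).1 t i) ∧ (∀ j, 0 < (Q.iter r).2 t j)) ∧
    ∃ lam : TGOSPA.Duals m n S, Q.IsDualOptimal lam ∧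
      TGOSPA.ConvergesLinearly (fun r => Q.toDual (Q.iter r)) lam := by
  refine ⟨Q.iter_pos hm hn hc, ?_⟩
  obtain ⟨x, hx, hlim⟩ := TGOSPA.exists_convergesLinearly_of_blockPath
    (Q.supportWeight_pos hc) (TGOSPA.Problem.feasiblePlan_pos hm hn) one_pos
    TGOSPA.Problem.norm_le_of_mem_block TGOSPA.Problem.exists_block_decomposition _ _
    (Q.blockPath_iter hm hn hc)
  -- `toDual` is `ε` times `logDual` by definition, so scaling carries over the limit and the rate.
  refine ⟨Q.ε • x, fun lam => ?_, hlim.const_smul Q.ε⟩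
  have e : lam = Q.ε • (Q.ε⁻¹ • lam) := by rw [smul_smul, mul_inv_cancel₀ hε.ne', one_smul]
  rw [e, Q.dualObj_eq hm hc hε, Q.dualObj_eq hm hc hε]
  have := mul_le_mul_of_nonneg_left (hx (Q.ε⁻¹ • lam)) hε.le
  linarith
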